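/- Let $B_m$ denote the Bernoulli numbers, $\frac{z}{e^z-1}=\sum_{m\ge 0}B_m\frac{z^m}{m!}$, let $\varphi$ be Euler's totient function, and let $|\cdot|_p$ be the $p$-adic absolute value normalized by $|p|_p=p^{-1}$. In all that follows $p$ denotes a prime. **Irregular pairs.** For $k\ge 1$ let $$\Psi^{\rm irr}_k=\{(p,l) : p^k\mid B_l/l,\ 2\le l<\varphi(p^k),\ 2\mid l\},$$ where $p^k\mid B_l/l$ means that $p^k$ divides the numerator of $B_l/l$ in lowest terms. For $(p,l)\in\Psi^{\rm irr}_1$ let $\Delta_{(p,l)}\in\{0,\dots,p-1\}$ be the residue $$\Delta_{(p,l)}\equiv p^{-1}\Big(\frac{B_{l+p-1}}{l+p-1}-\frac{B_l}{l}\Big)\pmod p .$$ **Nonsingular case.** If $(p,l)\in\Psi^{\rm irr}_1$ and $\Delta_{(p,l)}\ne 0$, there is a unique sequence $(s_\nu)_{\nu\ge 1}$ of integers with $0\le s_\nu<p$, $s_1=l$, and $\big(p,\sum_{\nu=1}^{k}s_\nu\varphi(p^{\nu-1})\big)\in\Psi^{\rm irr}_k$ for all $k\ge 1$. Put $$\chi_{(p,l)}=\sum_{\nu\ge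 0}s_{\nu+2}\,p^\nu\in\mathbb Z_p .$$ **Singular case.** If $(p,l)\in\Psi^{\rm irr}_1$ and $\Delta_{(p,l)}=0$, let $T^0_{(p,l)}$ be the rooted tree whose nodes contain pairs (not necessarily distinct) as follows. The root, of height $0$, contains $(p,l)$. A node of height $r$ containing $(p,m)$ has no children if $(p,m)\notin\Psi^{\rm irr}_{r+2}$; if $(p,m)\in\Psi^{\rm irr}_{r+2}$, it has $p$ children, of height $r+1$, containing $(p,m+j\varphi(p^{r+1}))$ for $j=0,\dots,p-1$. For an even positive integer $n\equiv l \pmod{p-1}$ put $$h_0(p,n)=\max\{r\ge 0 : T^0_{(p,l)}\text{ has a node of height } r \text{ containing } (p,\ n \bmod \varphi(p^{r+1}))\}.$$ **Statement.** Let $n$ be an even positive integer. The sequences $(s_\nu)$ defining $\chi_{(p,l)}$ exist and are unique whenever $(p,l)\in\Psi^{\rm irr}_1$ and $\Delta_{(p,l)}\neq0$; the maximum $h_0(p,n)$ exists for each $(p,l)\in\Psi^{\rm irr}_1$ with $\Delta_{(p,l)}=0$ and $n\equiv l\pmod{p-1}$; only finitely many $(p,l)\in\Psi^{\rm irr}_1$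 satisfy $n\equiv l\pmod{p-1}$, and only finitely many primes $p$ satisfy $p-1\mid n$; and $$\zeta(1-n)=(-1)^{\frac n2}\prod_{\substack{(p,l)\in\Psi^{\rm irr}_1,\ \Delta_{(p,l)}\neq 0\\ n\equiv l \,(\mathrm{mod}\ p-1)}}\Big|p\Big(\chi_{(p,l)}-\frac{n-l}{p-1}\Big)\Big|_p^{-1}\prod_{\substack{(p,l)\in\Psi^{\rm irr}_1,\ \Delta_{(p,l)}=0\\ n\equiv l\,(\mathrm{mod}\ p-1)}}p^{1+h_0(p,n)}\prod_{p-1\mid n}\frac{|n|_p}{p},$$ where $\zeta$ is the Riemann zeta function and the last product runs over all primes $p$ with $p-1\mid n$. -/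

import Mathlib

open scoped Nat

instance primesFactPrime (p : Nat.Primes) : Fact (Nat.Prime (p : ℕ)) := ⟨p.2⟩

/-- The set `Ψ_k` of irregular pairs `(p, l)` of order `k` (for `k ≥ 1`): `p` is prime, `l` is even,
`2 ≤ l < φ(p^k)`, and `p^k` divides (the numerator, in lowest terms, of) `B_l / l`. -/
def irregularPairs (k : ℕ) : Set (Nat.Primes × ℕ) :=
  {x | 2 ≤ x.2 ∧ x.2 < φ ((x.1 : ℕ) ^ k) ∧ Even x.2 ∧
    (((x.1 : ℕ) : ℤ) ^ k) ∣ (bernoulli x.2 / (x.2 : ℚ)).num}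

/-- The rational number `p^{-k} (B_{l + φ(p^k)} / (l + φ(p^k)) - B_l / l)`. It is `p`-integral when
`(p, l)` is an irregular pair of order `k`. -/
def irregularDeltaRat (k : ℕ) (x : Nat.Primes × ℕ) : ℚ :=
  (bernoulli (x.2 + φ ((x.1 : ℕ) ^ k)) / ((x.2 + φ ((x.1 : ℕ) ^ k) : ℕ) : ℚ)
    - bernoulli x.2 / (x.2 : ℚ)) / ((x.1 : ℕ) : ℚ) ^ k

/-- `Δ_{(p,l)}` for an irregular pair `(p, l)` of order `k`: the least nonnegative residue modulo `p`
of the `p`-integral rational number `irregularDeltaRat k (p, l)`. -/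
def irregularDelta (k : ℕ) (x : Nat.Primes × ℕ) : ℕ :=
  (((irregularDeltaRat k x).num : ZMod (x.1 : ℕ)) *
    ((irregularDeltaRat k x).den : ZMod (x.1 : ℕ))⁻¹).val

/-- `(p, s_1, …, s_k)` is an irregular pair of order `k` in `p`-adic notation. Here `s ν` stands for
`s_{ν+1}`; only the values `s 0, …, s (k-1)` matter. -/
def IsIrregularPadicNotation (p : Nat.Primes) (k : ℕ) (s : ℕ → ℕ) : Prop :=
  (∀ ν < k, s ν < p) ∧ Even (s 0) ∧ 2 ≤ s 0 ∧ s 0 + 3 ≤ p ∧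
    (p, ∑ ν ∈ Finset.range k, s ν * φ ((p : ℕ) ^ ν)) ∈ irregularPairs k

/-- `s = (s_1, s_2, …)` (with `s ν` standing for `s_{ν+1}`) starts with `s_1 = l`, and
`(p, s_1, …, s_k)` is an irregular pair of order `k` for every `k ≥ 1`. -/
def IsIrregularSequence (x : Nat.Primes × ℕ) (s : ℕ → ℕ) : Prop :=
  s 0 = x.2 ∧ ∀ k, 1 ≤ k → IsIrregularPadicNotation x.1 k s

/-- The characteristic `p`-adic integer `χ_{(p,l)} = ∑_{ν ≥ 0} s_{ν+2} p^ν`, where `(s_ν)_{ν ≥ 1}` is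
the sequence of digits attached to `(p, l)` (unique if `Δ_{(p,l)} ≠ 0`). -/
noncomputable def irregularChi (x : Nat.Primes × ℕ) : ℤ_[(x.1 : ℕ)] :=
  ∑' ν : ℕ, ((Classical.epsilon (IsIrregularSequence x) (ν + 1) : ℕ) : ℤ_[(x.1 : ℕ)]) *
    ((x.1 : ℕ) : ℤ_[(x.1 : ℕ)]) ^ ν

/-- The rooted tree `T⁰_{(p,l)}`: `SingularTreeNode p l r m` says that the tree has a node of height
`r` containing the pair `(p, m)`. The root contains `(p, l)`. A node of height `r` containing
`(p, m)`, a pair of order `r + 1`, has no children if `(p, m)` is not of order `r + 2`; otherwise it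
has the `p` children containing `(p, m + j φ(p^{r+1}))`, `0 ≤ j < p`. -/
inductive SingularTreeNode (p : Nat.Primes) (l : ℕ) : ℕ → ℕ → Prop
  | root : SingularTreeNode p l 0 l
  | child {r m : ℕ} (j : ℕ) : SingularTreeNode p l r m → (p, m) ∈ irregularPairs (r + 2) →
      j < p → SingularTreeNode p l (r + 1) (m + j * φ ((p : ℕ) ^ (r + 1)))

/-- The heights `r` at which the tree `T⁰_{(p,l)}` has a node containing `(p, n mod φ(p^{r+1}))`. -/
def singularHeights (x : Nat.Primes × ℕ) (n : ℕ) : Set ℕ :=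
  {r | SingularTreeNode x.1 x.2 r (n % φ ((x.1 : ℕ) ^ (r + 1)))}

/-- `h₀(p, n)`: the largest element of `singularHeights (p, l) n`, where `l ≡ n mod (p - 1)`. -/
noncomputable def singularHeight (x : Nat.Primes × ℕ) (n : ℕ) : ℕ :=
  sSup (singularHeights x n)

/-- The irregular pairs `(p, l)` of order one with `n ≡ l mod (p - 1)`. -/
def irregularPairsAt (n : ℕ) : Set (Nat.Primes × ℕ) :=
  {x | x ∈ irregularPairs 1 ∧ n ≡ x.2 [MOD ((x.1 : ℕ) - 1)]}

/-! ### Functions on the naturals with a `p`-adic slope -/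

section Slope

variable {p : ℕ} [Fact p.Prime]

/-! Up to sign, `ζ(1 - n) = -B_n / n` is the product over all primes of `|B_n / n|_p⁻¹`, so each
local factor has to be identified. If `p - 1 ∣ n`, von Staudt–Clausen gives `|B_n|_p = p`.

Otherwise `n = l + (p - 1) s` with `2 ≤ l < p - 1`, and everything follows from one refined Kummer
congruence (`exists_hasSlope_bernoulli`): the function `f s = (1 - p ^ (m - 1)) B_m / m`, `m = l +
(p - 1) s`, satisfies `f s - f t = p (s - t) (d + p x)` with `d` independent of `s, t`. It is proved
for Voronoi sums, whose terms are constants times powers of integers prime to `p`, and passes to the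
`p`-adic limit.

Modulo `p`, `f` is constant, so only irregular pairs contribute, and `Δ = 0` exactly when `p ∣ d`.
If `d` is a unit, `f` is `p` times an isometry; Newton's method yields its zero `χ`, and `|f s| = |p
(s - χ)|`. If `p ∣ d`, then `f t` modulo `p ^ (r + 2)` depends only on `t` modulo `p ^ r`; hence the
tree records exactly the zeros of `f` modulo `p ^ (r + 1)`, and `1 + h₀` is the valuation of `f s`.
-/

theorem PadicInt.dvd_iff_norm_le {a b : ℤ_[p]} : a ∣ b ↔ ‖b‖ ≤ ‖a‖ := by
  constructor
  · rintro ⟨c, rfl⟩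
    rw [norm_mul]
    exact mul_le_of_le_one_right (norm_nonneg _) c.norm_le_one
  · intro h
    rcases eq_or_ne a 0 with rfl | ha
    · rw [norm_zero, norm_le_zero_iff] at h
      rw [h]
    · have ha' : (a : ℚ_[p]) ≠ 0 := by simpa using ha
      have hc : ‖(b / a : ℚ_[p])‖ ≤ 1 := by
        rw [norm_div]
        exact div_le_one_of_le₀ (by simpa using h) (norm_nonneg _)
      obtain ⟨z, hz⟩ : ∃ z : ℤ_[p], (z : ℚ_[p]) = b / a := ⟨⟨_, hc⟩, rfl⟩
      refine ⟨z, PadicInt.ext ?_⟩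
      rw [PadicInt.coe_mul, hz]
      exact (mul_div_cancel₀ _ ha').symm

/-- For odd `p` and `i ≥ 2`, the `p`-adic valuation of `i` is at most `i - 2`. -/
theorem PadicInt.natCast_dvd_pow_sub_two (hp : p ≠ 2) {i : ℕ} (hi : 2 ≤ i) :
    ((i : ℕ) : ℤ_[p]) ∣ (p : ℤ_[p]) ^ (i - 2) := by
  have hpp : p.Prime := Fact.out
  have hp3 : 3 ≤ p := by have := hpp.two_le; omega
  obtain ⟨e, n, hn, rfl⟩ := Nat.exists_eq_pow_mul_and_not_dvd (n := i) (by omega) p hpp.ne_one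
  have hn0 : 0 < n := Nat.pos_of_ne_zero fun h => hn (h ▸ dvd_zero p)
  -- Here `p ≥ 3` is essential: the case `k = 2` fails for `p = 2`. With `i = p ^ e * n` it gives `p
  -- ^ e ≤ i < p ^ (i - 1)`, so `e ≤ i - 2`.
  have hlt : ∀ k : ℕ, 2 ≤ k → k < p ^ (k - 1) := by
    intro k hk
    induction k, hk using Nat.le_induction with
    | base => simpa using Nat.lt_of_succ_le hp3
    | succ k hk ih =>
      obtain ⟨j, rfl⟩ : ∃ j, k = j + 1 := ⟨k - 1, by omega⟩
      simp only [Nat.add_sub_cancel] at ih ⊢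
      calc j + 1 + 1 < p ^ j + p ^ j := by omega
        _ ≤ p ^ j * p := by nlinarith [pow_pos hpp.pos j]
        _ = p ^ (j + 1) := (pow_succ _ _).symm
  have he : e ≤ p ^ e * n - 2 := by
    have h1 : p ^ e < p ^ (p ^ e * n - 1) :=
      lt_of_le_of_lt (Nat.le_mul_of_pos_right _ hn0) (hlt _ hi)
    have := (Nat.pow_lt_pow_iff_right hpp.one_lt).1 h1
    omega
  have hu : IsUnit ((n : ℕ) : ℤ_[p]) := by
    rw [PadicInt.isUnit_iff, PadicInt.norm_natCast_eq_one_iff]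
    exact (Nat.Prime.coprime_iff_not_dvd hpp).2 hn
  push_cast
  rw [hu.mul_right_dvd]
  exact pow_dvd_pow _ he

/-- First-order Taylor expansion of `x ↦ x ^ m` at `p`-adic integers, with an error term that is
divisible by `m`. -/
theorem PadicInt.add_pow_mul_pow_sub (hp : p ≠ 2) (x y : ℤ_[p]) (m M : ℕ) (hM : M ≠ 0) :
    (m : ℤ_[p]) * (p : ℤ_[p]) ^ (2 * M) ∣
      (x + (p : ℤ_[p]) ^ M * y) ^ m - x ^ m - m * x ^ (m - 1) * ((p : ℤ_[p]) ^ M * y) := by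
  rcases m with _ | m
  · simp
  rw [add_comm x, add_pow, Finset.sum_range_succ', Finset.sum_range_succ']
  simp only [zero_add, pow_zero, pow_one, one_mul, Nat.choose_zero_right, Nat.choose_one_right,
    Nat.cast_one, mul_one, Nat.add_sub_cancel, Nat.sub_zero]
  have : ∀ z a b c : ℤ_[p], z + (a * b * c) + x ^ (m + 1) - x ^ (m + 1) - c * b * a = z := by
    intros; ring
  rw [this]
  refine Finset.dvd_sum fun i hi => ?_
  obtain ⟨z, hz⟩ := PadicInt.natCast_dvd_pow_sub_two (p := p) hp (i := i + 2) (by omega)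
  -- The factor `m + 1` is drawn out of the binomial coefficient at the price of a denominator `i +
  -- 2`. Since `M ≥ 1`, the power `p ^ (M * (i + 2))` contains `p ^ (2 * M) * p ^ i`, and `p ^ i`
  -- absorbs that denominator.
  have hch : ((m + 1 : ℕ) : ℤ_[p]) * (m.choose (i + 1) : ℕ) =
      ((m + 1).choose (i + 2) : ℕ) * ((i + 2 : ℕ) : ℤ_[p]) := by
    exact_mod_cast Nat.add_one_mul_choose_eq m (i + 1)
  have hpow : ((p : ℤ_[p]) ^ M) ^ (i + 2) =
      (p : ℤ_[p]) ^ (2 * M) * (((i + 2 : ℕ) : ℤ_[p]) * z) * (p : ℤ_[p]) ^ ((M - 1) * i) := by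
    rw [← hz, Nat.add_sub_cancel]
    simp only [← pow_mul, ← pow_add]
    congr 1
    obtain ⟨M, rfl⟩ := Nat.exists_eq_succ_of_ne_zero hM
    simp only [Nat.succ_eq_add_one, Nat.add_sub_cancel]
    ring
  refine ⟨(m.choose (i + 1) : ℕ) * z * (p : ℤ_[p]) ^ ((M - 1) * i) * y ^ (i + 2) *
    x ^ (m + 1 - (i + 1 + 1)), ?_⟩
  rw [mul_pow, show i + 1 + 1 = i + 2 from rfl, hpow]
  linear_combination (-(p : ℤ_[p]) ^ (2 * M) * z * (p : ℤ_[p]) ^ ((M - 1) * i) * y ^ (i + 2) *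
    x ^ (m + 1 - (i + 1 + 1))) * hch

/-- `f` is affine with slope `p * d`, up to an error in `f s - f t` divisible by `p² (s - t)`. -/
def HasSlope (f : ℕ → ℤ_[p]) (d : ℤ_[p]) : Prop :=
  ∀ s t : ℕ, (p : ℤ_[p]) ^ 2 * ((s : ℤ_[p]) - t) ∣ f s - f t - p * ((s : ℤ_[p]) - t) * d

namespace HasSlope

variable {f g : ℕ → ℤ_[p]} {d e : ℤ_[p]}

theorem const (c : ℤ_[p]) : HasSlope (fun _ => c) 0 := fun s t => by simp

theorem add (hf : HasSlope f d) (hg : HasSlope g e) : HasSlope (fun s => f s + g s) (d + e) :=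
  fun s t => by
    convert! dvd_add (hf s t) (hg s t) using 1
    ring

theorem sum {ι : Type*} (S : Finset ι) {F : ι → ℕ → ℤ_[p]} {D : ι → ℤ_[p]}
    (h : ∀ i ∈ S, HasSlope (F i) (D i)) :
    HasSlope (fun s => ∑ i ∈ S, F i s) (∑ i ∈ S, D i) := fun s t => by
  rw [Finset.mul_sum, ← Finset.sum_sub_distrib, ← Finset.sum_sub_distrib]
  exact Finset.dvd_sum fun i hi => h i hi s t

theorem exists_eq (hf : HasSlope f d) (s t : ℕ) :
    ∃ x, f s - f t = p * ((s : ℤ_[p]) - t) * (d + p * x) := by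
  obtain ⟨x, hx⟩ := hf s t
  exact ⟨x, by linear_combination hx⟩

/-- Leibniz rule. Evaluating the factors at `0` is harmless: they vary only by multiples of `p`, and
this variation is multiplied by `p (s - t)`. -/
theorem mul (hf : HasSlope f d) (hg : HasSlope g e) :
    HasSlope (fun s => f s * g s) (d * g 0 + f 0 * e) := fun s t => by
  obtain ⟨x, hx⟩ := hf.exists_eq s t
  obtain ⟨y, hy⟩ := hg.exists_eq s t
  obtain ⟨x', hx'⟩ := hf.exists_eq t 0
  obtain ⟨y', hy'⟩ := hg.exists_eq s 0
  refine ⟨x * g s + f t * y + d * s * (e + p * y') + e * t * (d + p * x'), ?_⟩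
  push_cast at hx' hy'
  linear_combination g s * hx + f t * hy + p * (s - t) * d * hy' + p * (s - t) * e * hx'

theorem inv (hf : HasSlope f d) (hfg : ∀ s, f s * g s = 1) :
    HasSlope g (-d * g 0 * g 0) := fun s t => by
  obtain ⟨x, hx⟩ := hf.exists_eq s t
  obtain ⟨x', hx'⟩ := hf.exists_eq t 0
  obtain ⟨y', hy'⟩ := hf.exists_eq s 0
  push_cast at hx' hy'
  have h1 : g s - g t = -(p * (s - t) * (d + p * x)) * g s * g t := by
    linear_combination (-g s * g t) * hx + g t * hfg s - g s * hfg t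
  have h2 : g s = g 0 - p * (s - 0) * (d + p * y') * g s * g 0 := by
    linear_combination (- g s * g 0) * hy' + g 0 * hfg s - g s * hfg 0
  have h3 : g t = g 0 - p * (t - 0) * (d + p * x') * g t * g 0 := by
    linear_combination (- g t * g 0) * hx' + g 0 * hfg t - g t * hfg 0
  refine ⟨-x * g s * g t + d * (s * (d + p * y') * g s * g 0 * g t)
    + d * g 0 * (t * (d + p * x') * g t * g 0), ?_⟩
  linear_combination h1 - p * (s - t) * d * g t * h2 - p * (s - t) * d * g 0 * h3

theorem pow (hp : p ≠ 2) (q : ℤ_[p]) : HasSlope (fun s : ℕ => (1 + (p : ℤ_[p]) * q) ^ s) q := by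
  have key : ∀ t k : ℕ, (p : ℤ_[p]) ^ 2 * (((t + k : ℕ) : ℤ_[p]) - t) ∣
      (1 + p * q) ^ (t + k) - (1 + p * q) ^ t - p * (((t + k : ℕ) : ℤ_[p]) - t) * q := by
    intro t k
    obtain ⟨x, hx⟩ := PadicInt.add_pow_mul_pow_sub hp 1 q k 1 one_ne_zero
    obtain ⟨y, hy⟩ : (p : ℤ_[p]) ∣ (1 + p * q) ^ t - 1 := by
      have := sub_dvd_pow_sub_pow (1 + p * q) 1 t
      rw [one_pow, add_sub_cancel_left] at this
      exact (dvd_mul_right _ _).trans this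
    simp only [one_pow, mul_one, pow_one] at hx
    refine ⟨(1 + p * q) ^ t * x + y * q, ?_⟩
    rw [pow_add]
    push_cast
    linear_combination (1 + p * q) ^ t * hx + (k * p * q) * hy
  intro s t
  rcases le_total t s with h | h
  · obtain ⟨k, rfl⟩ := Nat.exists_eq_add_of_le h
    exact key t k
  · obtain ⟨k, rfl⟩ := Nat.exists_eq_add_of_le h
    obtain ⟨x, hx⟩ := key s k
    exact ⟨x, by linear_combination -hx⟩

theorem congr_mod_sq (hf : HasSlope f d) : (p : ℤ_[p]) ^ 2 ∣ f 1 - f 0 - p * d := by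
  simpa using hf 1 0

/-- Pointwise limits of functions with a slope have a slope. -/
theorem of_tendsto {F : ℕ → ℕ → ℤ_[p]} {D : ℕ → ℤ_[p]} (hF : ∀ M, HasSlope (F M) (D M))
    (hlim : ∀ s, Filter.Tendsto (fun M => F M s) Filter.atTop (nhds (f s))) :
    ∃ d, HasSlope f d := by
  have hdvd := @PadicInt.dvd_iff_norm_le p _
  have h1 : (p : ℤ_[p]) ∣ f 1 - f 0 := by
    rw [hdvd]
    refine le_of_tendsto ((hlim 1).sub (hlim 0)).norm (Filter.Eventually.of_forall fun M => ?_)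
    rw [← hdvd]
    obtain ⟨x, hx⟩ := (hF M).exists_eq 1 0
    exact ⟨D M + p * x, by rw [hx]; push_cast; ring⟩
  obtain ⟨d, hd⟩ := h1
  refine ⟨d, fun s t => ?_⟩
  -- The slopes `D M` need not converge. Each `p * D M` is replaced by `F M 1 - F M 0`, congruent to
  -- it modulo `p ^ 2` and convergent; divisibility is a closed condition.
  have h2 : (p : ℤ_[p]) ^ 2 * ((s : ℤ_[p]) - t) ∣
      f s - f t - ((s : ℤ_[p]) - t) * (f 1 - f 0) := by
    rw [hdvd]
    refine le_of_tendsto (((hlim s).sub (hlim t)).sub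
      (((hlim 1).sub (hlim 0)).const_mul ((s : ℤ_[p]) - t))).norm
      (Filter.Eventually.of_forall fun M => ?_)
    rw [← hdvd]
    obtain ⟨x, hx⟩ := hF M s t
    obtain ⟨y, hy⟩ := (hF M).congr_mod_sq
    exact ⟨x - y, by linear_combination hx - (s - t) * hy⟩
  rw [hd] at h2
  convert! h2 using 1
  ring

end HasSlope

end Slope

/-! ### Power sums, Voronoi sums and the second-order Kummer congruence -/

section PowerSums

variable {p : ℕ} [Fact p.Prime]

/-- By Faulhaber, the sum divided by `N = p ^ M` is a polynomial in `N` with constant term `B_m`,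
and `N` tends to `0`. -/
theorem tendsto_sum_range_pow_div (m : ℕ) :
    Filter.Tendsto (fun M : ℕ => (∑ a ∈ Finset.range (p ^ M), (a : ℚ_[p]) ^ m) / (p : ℚ_[p]) ^ M)
      Filter.atTop (nhds ((bernoulli m : ℚ) : ℚ_[p])) := by
  have hp0 : (p : ℚ_[p]) ≠ 0 := by exact_mod_cast (Fact.out : p.Prime).ne_zero
  have heq : ∀ M : ℕ, (∑ a ∈ Finset.range (p ^ M), (a : ℚ_[p]) ^ m) / (p : ℚ_[p]) ^ M =
      ∑ i ∈ Finset.range m, ((bernoulli i : ℚ) : ℚ_[p]) * ((m + 1).choose i : ℕ) / (m + 1) *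
        ((p : ℚ_[p]) ^ M) ^ (m - i) + ((bernoulli m : ℚ) : ℚ_[p]) := by
    intro M
    have h := congrArg (fun q : ℚ => (q : ℚ_[p])) (sum_range_pow (p ^ M) m)
    push_cast at h
    have hm : (m : ℚ_[p]) + 1 ≠ 0 := by exact_mod_cast Nat.succ_ne_zero m
    rw [h, Finset.sum_range_succ, add_div, Finset.sum_div]
    congr 1
    · refine Finset.sum_congr rfl fun i hi => ?_
      have := Finset.mem_range.1 hi
      rw [show m + 1 - i = (m - i) + 1 by omega, pow_succ]
      field_simp
    · rw [show m + 1 - m = 1 by omega, Nat.choose_succ_self_right]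
      push_cast
      field_simp
  simp_rw [heq]
  have hlim : Filter.Tendsto (fun M : ℕ => (p : ℚ_[p]) ^ M) Filter.atTop (nhds 0) :=
    tendsto_pow_atTop_nhds_zero_of_norm_lt_one Padic.norm_p_lt_one
  have h0 : Filter.Tendsto (fun M : ℕ =>
      ∑ i ∈ Finset.range m, ((bernoulli i : ℚ) : ℚ_[p]) * ((m + 1).choose i : ℕ) / (m + 1) *
        ((p : ℚ_[p]) ^ M) ^ (m - i)) Filter.atTop (nhds (∑ i ∈ Finset.range m, 0)) := by
    refine tendsto_finsetSum _ fun i hi => ?_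
    have := Finset.mem_range.1 hi
    have h1 := (hlim.pow (m - i)).const_mul
      (((bernoulli i : ℚ) : ℚ_[p]) * ((m + 1).choose i : ℕ) / (m + 1))
    rwa [zero_pow (by omega), mul_zero] at h1
  simpa using h0.add_const ((bernoulli m : ℚ) : ℚ_[p])

/-- The natural numbers below `p ^ M` that are prime to `p`. -/
def coprimeBelow (p M : ℕ) : Finset ℕ := (Finset.range (p ^ M)).filter fun a => ¬ p ∣ a

theorem sum_coprimeBelow_succ {R : Type*} [CommRing R] {q : ℕ} (hq : 0 < q) (M m : ℕ) :
    ∑ a ∈ coprimeBelow q (M + 1), (a : R) ^ m =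
      ∑ a ∈ Finset.range (q ^ (M + 1)), (a : R) ^ m -
        (q : R) ^ m * ∑ a ∈ Finset.range (q ^ M), (a : R) ^ m := by
  have himg : (Finset.range (q ^ (M + 1))).filter (fun a => q ∣ a) =
      (Finset.range (q ^ M)).image fun a => q * a := by
    ext a
    simp only [Finset.mem_filter, Finset.mem_range, Finset.mem_image]
    constructor
    · rintro ⟨h, b, rfl⟩
      refine ⟨b, ?_, rfl⟩
      rw [pow_succ'] at h
      exact lt_of_mul_lt_mul_left h (Nat.zero_le _)
    · rintro ⟨b, hb, rfl⟩
      refine ⟨?_, dvd_mul_right _ _⟩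
      rw [pow_succ']
      exact Nat.mul_lt_mul_of_pos_left hb hq
  have h := Finset.sum_filter_add_sum_filter_not (Finset.range (q ^ (M + 1))) (fun a => q ∣ a)
    fun a => (a : R) ^ m
  rw [himg, Finset.sum_image fun a _ b _ h => Nat.eq_of_mul_eq_mul_left hq h] at h
  rw [← h, coprimeBelow, Finset.mul_sum]
  push_cast
  simp_rw [mul_pow]
  ring

/-- The omitted multiples of `p` contribute `p ^ m` times the sum up to `p ^ M`; divided by `p ^ (M
+ 1)` this tends to `p ^ (m - 1) B_m`. -/
theorem tendsto_sum_coprimeBelow_div {m : ℕ} (hm : m ≠ 0) :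
    Filter.Tendsto (fun M : ℕ => (∑ a ∈ coprimeBelow p (M + 1), (a : ℚ_[p]) ^ m) /
      (p : ℚ_[p]) ^ (M + 1)) Filter.atTop
      (nhds ((1 - (p : ℚ_[p]) ^ (m - 1)) * ((bernoulli m : ℚ) : ℚ_[p]))) := by
  have hp0 : (p : ℚ_[p]) ≠ 0 := by exact_mod_cast (Fact.out : p.Prime).ne_zero
  have h1 := tendsto_sum_range_pow_div (p := p) m
  have h2 := ((Filter.tendsto_add_atTop_iff_nat 1).2 h1).sub (h1.const_mul ((p : ℚ_[p]) ^ (m - 1)))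
  rw [sub_mul, one_mul]
  refine h2.congr fun M => ?_
  rw [sum_coprimeBelow_succ (Fact.out : p.Prime).pos]
  obtain ⟨m, rfl⟩ := Nat.exists_eq_succ_of_ne_zero hm
  simp only [Nat.succ_eq_add_one, Nat.add_sub_cancel, pow_succ]
  field_simp

theorem sum_coprimeBelow_mul_mod {R : Type*} [AddCommMonoid R] {c : ℕ} (hc : ¬ p ∣ c) {M : ℕ}
    (hM : M ≠ 0) (F : ℕ → R) :
    ∑ a ∈ coprimeBelow p M, F (c * a % p ^ M) = ∑ a ∈ coprimeBelow p M, F a := by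
  have hpp : p.Prime := Fact.out
  have hmaps : ∀ a ∈ coprimeBelow p M, c * a % p ^ M ∈ coprimeBelow p M := by
    intro a ha
    simp only [coprimeBelow, Finset.mem_filter, Finset.mem_range] at ha ⊢
    refine ⟨Nat.mod_lt _ (pow_pos hpp.pos _), fun h => ?_⟩
    rw [Nat.dvd_mod_iff (dvd_pow_self p hM), hpp.dvd_mul] at h
    exact h.elim hc ha.2
  have hinj : Set.InjOn (fun a => c * a % p ^ M) (coprimeBelow p M) := by
    intro a ha b hb hab
    simp only [coprimeBelow, Finset.coe_filter, Finset.mem_range, Set.mem_ofPred_eq] at ha hb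
    have hcop : Nat.gcd (p ^ M) c = 1 :=
      Nat.Coprime.pow_left _ ((Nat.Prime.coprime_iff_not_dvd hpp).2 hc)
    have : a ≡ b [MOD p ^ M] := Nat.ModEq.cancel_left_of_coprime hcop hab
    exact Nat.ModEq.eq_of_lt_of_lt this ha.1 hb.1
  exact Finset.sum_nbij (fun a => c * a % p ^ M) hmaps hinj
    (Finset.surjOn_of_injOn_of_card_le _ hmaps hinj le_rfl) fun _ _ => rfl

/-- A Voronoi-type sum, which approximates `(c ^ m - 1) (1 - p ^ (m - 1)) B_m / m` modulo `p ^ M`. -/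
noncomputable def voronoiSum (p : ℕ) [Fact p.Prime] (c M m : ℕ) : ℤ_[p] :=
  ∑ a ∈ coprimeBelow p M, ((c * a / p ^ M : ℕ) : ℤ_[p]) * ((c * a : ℕ) : ℤ_[p]) ^ (m - 1)

/-- Multiplication by `c` permutes the residues prime to `p`, so the power sum may be taken over `c
* a % p ^ M = c * a - p ^ M * (c * a / p ^ M)`. The linear Taylor term is the Voronoi sum; after
division by `m * p ^ M` the error is still divisible by `p ^ M`. -/
theorem dvd_mul_sum_coprimeBelow_sub (hp : p ≠ 2) {c : ℕ} (hc : ¬ p ∣ c) {M : ℕ} (hM : M ≠ 0)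
    (m : ℕ) :
    (m : ℤ_[p]) * (p : ℤ_[p]) ^ (2 * M) ∣
      ((c : ℤ_[p]) ^ m - 1) * ∑ a ∈ coprimeBelow p M, (a : ℤ_[p]) ^ m -
        m * (p : ℤ_[p]) ^ M * voronoiSum p c M m := by
  have h1 : (c : ℤ_[p]) ^ m * ∑ a ∈ coprimeBelow p M, (a : ℤ_[p]) ^ m =
      ∑ a ∈ coprimeBelow p M, ((c * a : ℕ) : ℤ_[p]) ^ m := by
    rw [Finset.mul_sum]
    refine Finset.sum_congr rfl fun a _ => ?_
    push_cast
    ring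
  rw [sub_mul, one_mul, h1, ← sum_coprimeBelow_mul_mod hc hM fun a => (a : ℤ_[p]) ^ m, voronoiSum,
    Finset.mul_sum, ← Finset.sum_sub_distrib, ← Finset.sum_sub_distrib]
  refine Finset.dvd_sum fun a _ => ?_
  have h2 : ((c * a % p ^ M : ℕ) : ℤ_[p]) =
      ((c * a : ℕ) : ℤ_[p]) + (p : ℤ_[p]) ^ M * -((c * a / p ^ M : ℕ) : ℤ_[p]) := by
    have h := congrArg (fun x : ℕ => (x : ℤ_[p])) (Nat.mod_add_div (c * a) (p ^ M))
    simp only [Nat.cast_add, Nat.cast_mul, Nat.cast_pow] at h ⊢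
    linear_combination h
  rw [h2, ← dvd_neg]
  convert! PadicInt.add_pow_mul_pow_sub hp ((c * a : ℕ) : ℤ_[p])
    (-((c * a / p ^ M : ℕ) : ℤ_[p])) m M hM using 1
  ring

theorem tendsto_voronoiSum (hp : p ≠ 2) {c : ℕ} (hc : ¬ p ∣ c) {m : ℕ} (hm : m ≠ 0) :
    Filter.Tendsto (fun M : ℕ => (voronoiSum p c (M + 1) m : ℚ_[p])) Filter.atTop
      (nhds (((c : ℚ_[p]) ^ m - 1) * ((1 - (p : ℚ_[p]) ^ (m - 1)) *
        ((bernoulli m / m : ℚ) : ℚ_[p])))) := by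
  have hp0 : (p : ℚ_[p]) ≠ 0 := by exact_mod_cast (Fact.out : p.Prime).ne_zero
  have hm0 : (m : ℚ_[p]) ≠ 0 := by exact_mod_cast hm
  have h1 := (tendsto_sum_coprimeBelow_div (p := p) hm).const_mul (((c : ℚ_[p]) ^ m - 1) / m)
  choose z hz using fun M : ℕ => dvd_mul_sum_coprimeBelow_sub hp hc (Nat.add_one_ne_zero M) m
  have h2 : Filter.Tendsto (fun M : ℕ => (p : ℚ_[p]) ^ (M + 1) * (z M : ℚ_[p])) Filter.atTop
      (nhds 0) := by
    have hlim : Filter.Tendsto (fun M : ℕ => (p : ℚ_[p]) ^ (M + 1)) Filter.atTop (nhds 0) :=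
      (Filter.tendsto_add_atTop_iff_nat 1).2
        (tendsto_pow_atTop_nhds_zero_of_norm_lt_one Padic.norm_p_lt_one)
    refine squeeze_zero_norm (fun M => ?_) (tendsto_norm_zero.comp hlim)
    rw [norm_mul]
    exact mul_le_of_le_one_right (norm_nonneg _) (z M).norm_le_one
  have h3 := h1.sub h2
  rw [sub_zero] at h3
  push_cast
  convert! h3 using 1
  · ext M
    have h := congrArg (fun x : ℤ_[p] => (x : ℚ_[p])) (hz M)
    simp only [PadicInt.coe_sub, PadicInt.coe_mul, PadicInt.coe_pow, PadicInt.coe_natCast,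
      PadicInt.coe_one, PadicInt.coe_sum] at h
    field_simp
    linear_combination -h
  · congr 1
    ring

theorem exists_pow_pred_eq {a : ℕ} (ha : ¬ p ∣ a) :
    ∃ q : ℤ_[p], (a : ℤ_[p]) ^ (p - 1) = 1 + p * q := by
  have h : (p : ℤ) ∣ (a : ℤ) ^ (p - 1) - 1 := by
    rw [← ZMod.intCast_eq_intCast_iff_dvd_sub]
    push_cast
    refine (ZMod.pow_card_sub_one_eq_one ?_).symm
    rwa [Ne, ZMod.natCast_eq_zero_iff]
  obtain ⟨k, hk⟩ := h
  refine ⟨k, ?_⟩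
  have := congrArg (fun z : ℤ => (z : ℤ_[p])) hk
  push_cast at this
  linear_combination this

theorem hasSlope_pow_arith (hp : p ≠ 2) {a : ℕ} (ha : ¬ p ∣ a) (l : ℕ) :
    ∃ d, HasSlope (fun s => (a : ℤ_[p]) ^ (l + (p - 1) * s)) d := by
  obtain ⟨q, hq⟩ := exists_pow_pred_eq ha
  simp_rw [pow_add, pow_mul, hq]
  exact ⟨_, (HasSlope.const _).mul (HasSlope.pow hp q)⟩

theorem exists_hasSlope_voronoiSum (hp : p ≠ 2) {c : ℕ} (hc : ¬ p ∣ c) {l : ℕ} (hl : l ≠ 0)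
    (M : ℕ) : ∃ d, HasSlope (fun s => voronoiSum p c M (l + (p - 1) * s)) d := by
  have : ∀ a ∈ coprimeBelow p M, ∃ d, HasSlope (fun s => ((c * a / p ^ M : ℕ) : ℤ_[p]) *
      ((c * a : ℕ) : ℤ_[p]) ^ (l + (p - 1) * s - 1)) d := by
    intro a ha
    have hca : ¬ p ∣ c * a := by
      rw [(Fact.out : p.Prime).dvd_mul, not_or]
      exact ⟨hc, (Finset.mem_filter.1 ha).2⟩
    obtain ⟨d, hd⟩ := hasSlope_pow_arith hp hca (l - 1)
    have heq : ∀ s, l + (p - 1) * s - 1 = l - 1 + (p - 1) * s := fun s => by omega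
    simp_rw [heq]
    exact ⟨_, (HasSlope.const _).mul hd⟩
  choose! D hD using this
  exact ⟨_, HasSlope.sum _ hD⟩

/-- A primitive root works. Such a `c` makes `c ^ m - 1` a unit for all `m ≡ l` modulo `p - 1`, so
this factor can be divided out of the Voronoi limit. -/
theorem exists_pow_ne_one {l : ℕ} (hl : ¬ p - 1 ∣ l) : ∃ c : ℕ, ¬ p ∣ c ∧ (c : ZMod p) ^ l ≠ 1 := by
  obtain ⟨g, hg⟩ := IsCyclic.exists_generator (α := (ZMod p)ˣ)
  refine ⟨(g : ZMod p).val, ?_, ?_⟩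
  · rw [← ZMod.natCast_eq_zero_iff, ZMod.natCast_zmod_val]
    exact g.ne_zero
  · rw [ZMod.natCast_zmod_val]
    intro h
    have h1 : g ^ l = 1 := Units.ext (by simpa using h)
    have h2 := orderOf_dvd_of_pow_eq_one h1
    rw [orderOf_eq_card_of_forall_mem_zpowers hg, Nat.card_eq_fintype_card,
      ZMod.card_units_eq_totient, Nat.totient_prime Fact.out] at h2
    exact hl h2

/-- Kummer's congruences, to second order: `s ↦ (1 - p ^ (m - 1)) B_m / m` with
`m = l + (p - 1) s` is `p`-integral and has a slope, for `p - 1 ∤ l`. -/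
theorem exists_hasSlope_bernoulli (hp : p ≠ 2) {l : ℕ} (hl : ¬ p - 1 ∣ l) :
    ∃ (f : ℕ → ℤ_[p]) (d : ℤ_[p]), HasSlope f d ∧ ∀ s : ℕ,
      (f s : ℚ_[p]) = (1 - (p : ℚ_[p]) ^ (l + (p - 1) * s - 1)) *
        ((bernoulli (l + (p - 1) * s) / ((l + (p - 1) * s : ℕ) : ℚ) : ℚ) : ℚ_[p]) := by
  have hl0 : l ≠ 0 := fun h => hl (h ▸ dvd_zero _)
  obtain ⟨c, hc, hcl⟩ := exists_pow_ne_one hl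
  have hlim := fun s : ℕ => tendsto_voronoiSum hp hc (m := l + (p - 1) * s) (by omega)
  have hint : ∀ s : ℕ, ‖((c : ℚ_[p]) ^ (l + (p - 1) * s) - 1) *
      ((1 - (p : ℚ_[p]) ^ (l + (p - 1) * s - 1)) *
        ((bernoulli (l + (p - 1) * s) / ((l + (p - 1) * s : ℕ) : ℚ) : ℚ) : ℚ_[p]))‖ ≤ 1 := fun s =>
    le_of_tendsto (hlim s).norm (Filter.Eventually.of_forall fun M =>
      (voronoiSum p c (M + 1) (l + (p - 1) * s)).norm_le_one)
  obtain ⟨G, hG⟩ : ∃ G : ℕ → ℤ_[p], ∀ s, (G s : ℚ_[p]) = ((c : ℚ_[p]) ^ (l + (p - 1) * s) - 1) *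
      ((1 - (p : ℚ_[p]) ^ (l + (p - 1) * s - 1)) *
        ((bernoulli (l + (p - 1) * s) / ((l + (p - 1) * s : ℕ) : ℚ) : ℚ) : ℚ_[p])) :=
    ⟨fun s => ⟨_, hint s⟩, fun s => rfl⟩
  choose D hD using exists_hasSlope_voronoiSum hp hc hl0
  obtain ⟨e, he⟩ := HasSlope.of_tendsto (f := G) (fun M => hD (M + 1))
    fun s => tendsto_subtype_rng.2 (by simpa only [hG] using hlim s)
  obtain ⟨e', he'⟩ := hasSlope_pow_arith hp hc l
  have hunit : ∀ s : ℕ, IsUnit ((c : ℤ_[p]) ^ (l + (p - 1) * s) + -1) := by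
    intro s
    have : (c : ℤ_[p]) ^ (l + (p - 1) * s) + -1 =
        (((c : ℤ) ^ (l + (p - 1) * s) + -1 : ℤ) : ℤ_[p]) := by push_cast; rfl
    rw [this, PadicInt.isUnit_iff]
    refine le_antisymm (PadicInt.norm_le_one _) (not_lt.1 fun h => ?_)
    rw [PadicInt.norm_int_lt_one_iff_dvd, ← ZMod.intCast_zmod_eq_zero_iff_dvd] at h
    push_cast at h
    rw [pow_add, pow_mul, ZMod.pow_card_sub_one_eq_one
      (by rwa [Ne, ZMod.natCast_eq_zero_iff]), one_pow, mul_one] at h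
    exact hcl (by linear_combination h)
  choose H hH using fun s => (hunit s).exists_right_inv
  refine ⟨fun s => G s * H s, _, he.mul ((he'.add (HasSlope.const (-1))).inv hH), fun s => ?_⟩
  have h := congrArg (fun x : ℤ_[p] => (x : ℚ_[p])) (hH s)
  simp only [PadicInt.coe_add, PadicInt.coe_neg, PadicInt.coe_mul, PadicInt.coe_pow,
    PadicInt.coe_natCast, PadicInt.coe_one] at h
  rw [PadicInt.coe_mul, hG]
  linear_combination (1 - (p : ℚ_[p]) ^ (l + (p - 1) * s - 1)) *
        ((bernoulli (l + (p - 1) * s) / ((l + (p - 1) * s : ℕ) : ℚ) : ℚ) : ℚ_[p]) * h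

end PowerSums

/-! ### Irregular pairs and `Δ` in terms of the Kummer function -/

section KummerFunction

/-- For `k = 0` this fails: the right side would assert `p`-integrality. For `k ≥ 1`, divisibility
of the numerator makes the denominator prime to `p`. -/
theorem Rat.pow_dvd_num_iff_norm_le {p : ℕ} [Fact p.Prime] (q : ℚ) {k : ℕ} (hk : k ≠ 0) :
    (p : ℤ) ^ k ∣ q.num ↔ ‖(q : ℚ_[p])‖ ≤ ‖(p : ℚ_[p]) ^ k‖ := by
  have hpp : p.Prime := Fact.out
  have hq : (q : ℚ_[p]) = (q.num : ℚ_[p]) / (q.den : ℚ_[p]) := by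
    exact_mod_cast congrArg (fun x : ℚ => (x : ℚ_[p])) (Rat.num_div_den q).symm
  have hint : (p : ℤ) ^ k ∣ q.num ↔ ‖(q.num : ℚ_[p])‖ ≤ ‖(p : ℚ_[p]) ^ k‖ := by
    rw [Padic.norm_p_pow, Padic.norm_int_le_pow_iff_dvd]
  have hcop : ∀ h : ‖(q.num : ℚ_[p])‖ < 1, ‖(q.den : ℚ_[p])‖ = 1 := by
    intro h
    rw [Padic.norm_intCast_lt_one_iff] at h
    rw [Padic.norm_natCast_eq_one_iff, Nat.Prime.coprime_iff_not_dvd hpp]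
    intro h'
    have := Nat.dvd_gcd (Int.natCast_dvd.1 h) h'
    rw [q.reduced.gcd_eq_one] at this
    exact hpp.one_lt.ne' (Nat.dvd_one.1 this)
  have hlt : ‖(p : ℚ_[p]) ^ k‖ < 1 := by
    rw [norm_pow]
    exact pow_lt_one₀ (norm_nonneg _) Padic.norm_p_lt_one hk
  constructor
  · intro h
    rw [hint] at h
    rwa [hq, norm_div, hcop (h.trans_lt hlt), div_one]
  · intro h
    have hden : ‖(q.den : ℚ_[p])‖ ≤ 1 := by exact_mod_cast Padic.norm_int_le_one (p := p) q.den
    have hden0 : 0 < ‖(q.den : ℚ_[p])‖ := norm_pos_iff.2 (by exact_mod_cast q.den_nz)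
    rw [hint]
    refine le_trans ?_ h
    rw [hq, norm_div]
    exact le_div_self (norm_nonneg _) hden0 hden

/-- `f` is the function `s ↦ (1 - p ^ (m - 1)) B_m / m` with `m = l + (p - 1) s`. -/
def IsKummerFunction {p : ℕ} [Fact p.Prime] (l : ℕ) (f : ℕ → ℤ_[p]) : Prop :=
  ∀ s : ℕ, (f s : ℚ_[p]) = (1 - (p : ℚ_[p]) ^ (l + (p - 1) * s - 1)) *
    ((bernoulli (l + (p - 1) * s) / ((l + (p - 1) * s : ℕ) : ℚ) : ℚ) : ℚ_[p])

namespace IsKummerFunction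

section

variable {p : ℕ} [Fact p.Prime] {l : ℕ} {f : ℕ → ℤ_[p]} {d : ℤ_[p]}

theorem norm_eq (hf : IsKummerFunction l f) (hl : 2 ≤ l) (s : ℕ) :
    ‖f s‖ = ‖((bernoulli (l + (p - 1) * s) / ((l + (p - 1) * s : ℕ) : ℚ) : ℚ) : ℚ_[p])‖ := by
  have h1 : ‖(p : ℚ_[p]) ^ (l + (p - 1) * s - 1)‖ < 1 := by
    rw [norm_pow]
    exact pow_lt_one₀ (norm_nonneg _) Padic.norm_p_lt_one (by omega)
  have h2 : ‖(1 - (p : ℚ_[p]) ^ (l + (p - 1) * s - 1))‖ = 1 := by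
    rw [sub_eq_add_neg, Padic.add_eq_max_of_ne (by rw [norm_neg, norm_one]; exact h1.ne'),
      norm_neg, norm_one, max_eq_left h1.le]
  rw [← PadicInt.padic_norm_e_of_padicInt, hf s, norm_mul, h2, one_mul]

theorem pow_dvd_num_iff (hf : IsKummerFunction l f) (hl : 2 ≤ l) (s : ℕ) {k : ℕ} (hk : k ≠ 0) :
    (p : ℤ) ^ k ∣ (bernoulli (l + (p - 1) * s) / ((l + (p - 1) * s : ℕ) : ℚ)).num ↔
      (p : ℤ_[p]) ^ k ∣ f s := by
  rw [Rat.pow_dvd_num_iff_norm_le _ hk, ← hf.norm_eq hl, PadicInt.dvd_iff_norm_le]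
  simp

end

variable {p : Nat.Primes} {l : ℕ} {f : ℕ → ℤ_[(p : ℕ)]} {d : ℤ_[(p : ℕ)]}

theorem mem_irregularPairs_iff (hf : IsKummerFunction l f) (hl : 2 ≤ l) (hlp : l < (p : ℕ) - 1)
    (he : Even l) (s k : ℕ) :
    (p, l + ((p : ℕ) - 1) * s) ∈ irregularPairs (k + 1) ↔
      s < (p : ℕ) ^ k ∧ ((p : ℕ) : ℤ_[(p : ℕ)]) ^ (k + 1) ∣ f s := by
  have hodd : Even ((p : ℕ) - 1) := p.2.even_sub_one (by omega)
  simp only [irregularPairs, Set.mem_ofPred_eq]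
  rw [hf.pow_dvd_num_iff hl s (Nat.succ_ne_zero k), Nat.totient_prime_pow_succ p.2]
  have h1 : l + ((p : ℕ) - 1) * s < (p : ℕ) ^ k * ((p : ℕ) - 1) ↔ s < (p : ℕ) ^ k := by
    constructor
    · intro h
      by_contra! h'
      have := Nat.mul_le_mul_left ((p : ℕ) - 1) h'
      rw [mul_comm ((p : ℕ) ^ k)] at h
      omega
    · intro h
      have := Nat.mul_le_mul_left ((p : ℕ) - 1) (Nat.succ_le_of_lt h)
      rw [mul_comm ((p : ℕ) ^ k)]
      rw [Nat.mul_succ] at this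
      omega
  rw [h1]
  have h2 : Even (l + ((p : ℕ) - 1) * s) := he.add (hodd.mul_right s)
  have h3 : 2 ≤ l + ((p : ℕ) - 1) * s := by omega
  tauto

theorem exists_of_mem {x : Nat.Primes × ℕ} (hx : x ∈ irregularPairs 1) :
    2 ≤ x.2 ∧ x.2 < (x.1 : ℕ) - 1 ∧ Even x.2 ∧
    ∃ (f : ℕ → ℤ_[(x.1 : ℕ)]) (d : ℤ_[(x.1 : ℕ)]), HasSlope f d ∧ IsKummerFunction x.2 f ∧
      ((x.1 : ℕ) : ℤ_[(x.1 : ℕ)]) ∣ f 0 := by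
  obtain ⟨p, l⟩ := x
  have hx' := hx
  simp only [irregularPairs, Set.mem_ofPred_eq, pow_one, Nat.totient_prime p.2] at hx'
  obtain ⟨h1, h2, h3, -⟩ := hx'
  have hl : ¬ (p : ℕ) - 1 ∣ l := fun h => absurd (Nat.le_of_dvd (by omega) h) (by omega)
  obtain ⟨f, d, hfd, hf⟩ := exists_hasSlope_bernoulli (p := (p : ℕ)) (by omega) hl
  refine ⟨h1, h2, h3, f, d, hfd, hf, ?_⟩
  have := (mem_irregularPairs_iff hf h1 h2 h3 0 0).1 (by simpa using hx)
  simpa using this.2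

/-- `Δ` is the difference quotient of `B_m / m` without Euler factors. Inserting them changes the
two values by `p ^ (l + p - 2) * b 1` and `p ^ (l - 1) * b 0`, both divisible by `p ^ 2` because `l
≥ 2` and `p ∣ b 0`; so the quotient is `d` modulo `p`. -/
theorem irregularDelta_eq_zero_iff (hfd : HasSlope f d) (hf : IsKummerFunction l f) (hl : 2 ≤ l)
    (hlp : l < (p : ℕ) - 1) (h0 : ((p : ℕ) : ℤ_[(p : ℕ)]) ∣ f 0) :
    irregularDelta 1 (p, l) = 0 ↔ ((p : ℕ) : ℤ_[(p : ℕ)]) ∣ d := by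
  have hp0 : ((p : ℕ) : ℚ_[(p : ℕ)]) ≠ 0 := by exact_mod_cast p.2.ne_zero
  have hb : ∀ s, ∃ b : ℤ_[(p : ℕ)], (b : ℚ_[(p : ℕ)]) =
      ((bernoulli (l + ((p : ℕ) - 1) * s) / ((l + ((p : ℕ) - 1) * s : ℕ) : ℚ) : ℚ) :
        ℚ_[(p : ℕ)]) := fun s =>
    ⟨⟨_, by rw [← hf.norm_eq hl]; exact PadicInt.norm_le_one _⟩, rfl⟩
  choose b hb using hb
  have hfb : ∀ s, f s = (1 - ((p : ℕ) : ℤ_[(p : ℕ)]) ^ (l + ((p : ℕ) - 1) * s - 1)) * b s := by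
    intro s
    apply PadicInt.ext
    rw [hf s, PadicInt.coe_mul, hb]
    simp
  have hb0 : ((p : ℕ) : ℤ_[(p : ℕ)]) ∣ b 0 := by
    rw [PadicInt.dvd_iff_norm_le] at h0 ⊢
    rw [← PadicInt.padic_norm_e_of_padicInt (b 0), hb, ← hf.norm_eq hl]
    exact h0
  obtain ⟨x, hx⟩ := hfd.congr_mod_sq
  obtain ⟨y, hy⟩ := hb0
  have hδ : (irregularDeltaRat 1 (p, l) : ℚ_[(p : ℕ)]) = ((d + (p : ℕ) * x +
      ((p : ℕ) : ℤ_[(p : ℕ)]) ^ (l + ((p : ℕ) - 1) - 2) * b 1 -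
      ((p : ℕ) : ℤ_[(p : ℕ)]) ^ (l - 1) * y : ℤ_[(p : ℕ)]) : ℚ_[(p : ℕ)]) := by
    have h2 : (irregularDeltaRat 1 (p, l) : ℚ_[(p : ℕ)]) * (p : ℕ) = ((b 1 - b 0 : ℤ_[(p : ℕ)]) :
        ℚ_[(p : ℕ)]) := by
      rw [PadicInt.coe_sub, hb, hb]
      simp only [irregularDeltaRat, pow_one, Nat.totient_prime p.2, mul_one, mul_zero, add_zero]
      push_cast
      field_simp
    rw [← mul_left_inj' hp0, h2, ← PadicInt.coe_natCast, ← PadicInt.coe_mul]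
    refine congrArg (fun z : ℤ_[(p : ℕ)] => (z : ℚ_[(p : ℕ)])) ?_
    have h3 := hfb 1
    have h4 := hfb 0
    obtain ⟨n, rfl⟩ := Nat.exists_eq_add_of_le hl
    rw [show 2 + n + ((p : ℕ) - 1) * 1 - 1 = n + ((p : ℕ) - 1) + 1 by omega] at h3
    rw [show 2 + n + ((p : ℕ) - 1) * 0 - 1 = n + 1 by omega] at h4
    rw [show 2 + n + ((p : ℕ) - 1) - 2 = n + ((p : ℕ) - 1) by omega,
      show 2 + n - 1 = n + 1 by omega]
    linear_combination hx - h3 + h4 - ((p : ℕ) : ℤ_[(p : ℕ)]) ^ (n + 1) * hy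
  have hiff : ((p : ℕ) : ℤ) ^ 1 ∣ (irregularDeltaRat 1 (p, l)).num ↔
      ((p : ℕ) : ℤ_[(p : ℕ)]) ∣ d := by
    have hδd : ((p : ℕ) : ℤ_[(p : ℕ)]) ∣ (d + (p : ℕ) * x +
      ((p : ℕ) : ℤ_[(p : ℕ)]) ^ (l + ((p : ℕ) - 1) - 2) * b 1 -
      ((p : ℕ) : ℤ_[(p : ℕ)]) ^ (l - 1) * y) ↔ ((p : ℕ) : ℤ_[(p : ℕ)]) ∣ d := by
      have e1 : ((p : ℕ) : ℤ_[(p : ℕ)]) ∣ ((p : ℕ) : ℤ_[(p : ℕ)]) ^ (l - 1) * y :=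
        (dvd_pow_self _ (by omega)).mul_right _
      have e2 : ((p : ℕ) : ℤ_[(p : ℕ)]) ∣
          ((p : ℕ) : ℤ_[(p : ℕ)]) ^ (l + ((p : ℕ) - 1) - 2) * b 1 :=
        (dvd_pow_self _ (by omega)).mul_right _
      rw [dvd_sub_left e1, dvd_add_left e2, dvd_add_left (dvd_mul_right _ _)]
    rw [Rat.pow_dvd_num_iff_norm_le _ one_ne_zero, hδ, ← hδd, PadicInt.dvd_iff_norm_le,
      PadicInt.padic_norm_e_of_padicInt]
    simp
  -- In `ZMod p` the inverse of `0` is `0`, so the denominator must be known to be prime to `p`.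
  have hden : ((irregularDeltaRat 1 (p, l)).den : ZMod (p : ℕ)) ≠ 0 := by
    rw [Ne, ZMod.natCast_eq_zero_iff]
    intro h
    have h1 : ‖(irregularDeltaRat 1 (p, l) : ℚ_[(p : ℕ)])‖ ≤ 1 := by
      rw [hδ]; exact PadicInt.norm_le_one _
    have h2 := PadicInt.isUnit_iff.1 (PadicInt.isUnit_den _ h1)
    rw [PadicInt.norm_natCast_eq_one_iff, Nat.Prime.coprime_iff_not_dvd p.2] at h2
    exact h2 h
  rw [← hiff, irregularDelta, ZMod.val_eq_zero, mul_eq_zero, inv_eq_zero, or_iff_left hden,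
    ZMod.intCast_zmod_eq_zero_iff_dvd, pow_one]

end IsKummerFunction

end KummerFunction

/-! ### The nonsingular case: a unique `p`-adic zero -/

section Nonsingular

section Digits

variable {p : ℕ} [Fact p.Prime] {f : ℕ → ℤ_[p]} {d : ℤ_[p]}

theorem sum_digits_lt {b : ℕ} {e : ℕ → ℕ} (he : ∀ i, e i < b) (k : ℕ) :
    ∑ i ∈ Finset.range k, e i * b ^ i < b ^ k := by
  induction k with
  | zero => simp
  | succ k ih =>
    rw [Finset.sum_range_succ, pow_succ']
    have := Nat.mul_le_mul_right (b ^ k) (Nat.succ_le_of_lt (he k))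
    rw [Nat.succ_mul] at this
    omega

theorem HasSlope.norm_sub (hf : HasSlope f d) (hd : ¬ (p : ℤ_[p]) ∣ d) (s t : ℕ) :
    ‖f s - f t‖ = ‖(p : ℤ_[p]) * ((s : ℤ_[p]) - t)‖ := by
  obtain ⟨x, hx⟩ := hf.exists_eq s t
  have : ‖d + p * x‖ = 1 := by
    refine le_antisymm (PadicInt.norm_le_one _) (not_lt.1 fun h => hd ?_)
    rw [PadicInt.norm_lt_one_iff_dvd] at h
    exact (dvd_add_left (dvd_mul_right _ _)).1 h
  rw [hx, norm_mul, this, mul_one]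

/-- Newton step: if `f t = p ^ (k + 1) * a`, then `f (t + j * p ^ k) ≡ p ^ (k + 1) * (a + j * d)`
modulo `p ^ (k + 2)`, and `j ≡ -a / d` is the required digit. -/
theorem HasSlope.exists_digit (hf : HasSlope f d) (hd : ¬ (p : ℤ_[p]) ∣ d) {k t : ℕ}
    (ht : (p : ℤ_[p]) ^ (k + 1) ∣ f t) :
    ∃ j < p, (p : ℤ_[p]) ^ (k + 2) ∣ f (t + j * p ^ k) := by
  obtain ⟨a, ha⟩ := ht
  have hu : IsUnit d := by
    rw [PadicInt.isUnit_iff]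
    refine le_antisymm (PadicInt.norm_le_one _) (not_lt.1 fun h => hd ?_)
    rwa [PadicInt.norm_lt_one_iff_dvd] at h
  obtain ⟨d', hd'⟩ := hu.exists_right_inv
  refine ⟨(-a * d').zmodRepr, PadicInt.zmodRepr_lt_p _, ?_⟩
  have h := PadicInt.sub_zmodRepr_mem (-a * d')
  rw [PadicInt.maximalIdeal_eq_span_p, Ideal.mem_span_singleton] at h
  generalize (-a * d').zmodRepr = j at h ⊢
  obtain ⟨y, hy⟩ := h
  obtain ⟨x, hx⟩ := hf.exists_eq (t + j * p ^ k) t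
  push_cast at hx
  refine ⟨j * x - d * y, ?_⟩
  linear_combination hx + ha - (p : ℤ_[p]) ^ (k + 1) * d * hy - (p : ℤ_[p]) ^ (k + 1) * a * hd'

/-- A function with unit slope that vanishes modulo `p` at `0` has a unique `p`-adic zero. -/
theorem HasSlope.existsUnique_digits (hf : HasSlope f d) (hd : ¬ (p : ℤ_[p]) ∣ d)
    (h0 : (p : ℤ_[p]) ∣ f 0) :
    ∃! e : ℕ → ℕ, (∀ i, e i < p) ∧
      ∀ k, (p : ℤ_[p]) ^ (k + 1) ∣ f (∑ i ∈ Finset.range k, e i * p ^ i) := by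
  have hstep : ∀ k t : ℕ, ∃ j < p, (p : ℤ_[p]) ^ (k + 1) ∣ f t →
      (p : ℤ_[p]) ^ (k + 2) ∣ f (t + j * p ^ k) := by
    intro k t
    by_cases ht : (p : ℤ_[p]) ^ (k + 1) ∣ f t
    · obtain ⟨j, hj, h⟩ := hf.exists_digit hd ht
      exact ⟨j, hj, fun _ => h⟩
    · exact ⟨0, (Fact.out : p.Prime).pos, fun h => absurd h ht⟩
  choose J hJ hJ' using hstep
  let T : ℕ → ℕ := fun k => Nat.rec 0 (fun k t => t + J k t * p ^ k) k
  have hT : ∀ k, T k = ∑ i ∈ Finset.range k, J i (T i) * p ^ i := by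
    intro k
    induction k with
    | zero => rfl
    | succ k ih => rw [Finset.sum_range_succ, ← ih]
  refine ⟨fun i => J i (T i), ⟨fun i => hJ _ _, fun k => ?_⟩, ?_⟩
  · simp only [← hT]
    induction k with
    | zero => simpa [T] using h0
    | succ k ih => exact hJ' k (T k) ih
  · rintro e ⟨he, hef⟩
    funext k
    induction k using Nat.strong_induction_on with
    | _ k ih =>
      have hs : ∑ i ∈ Finset.range k, e i * p ^ i = T k := by
        rw [hT]
        exact Finset.sum_congr rfl fun i hi => by rw [ih i (Finset.mem_range.1 hi)]
      have h1 := hef (k + 1)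
      rw [Finset.sum_range_succ, hs] at h1
      have hTk : ∀ k, (p : ℤ_[p]) ^ (k + 1) ∣ f (T k) := by
        intro k
        induction k with
        | zero => simpa [T] using h0
        | succ k ih => exact hJ' k (T k) ih
      have h2 := hTk (k + 1)
      -- Both candidates for digit `k` give values divisible by `p ^ (k + 2)`; since `f` is `p`
      -- times an isometry, the digits agree modulo `p`.
      have h3 := dvd_sub h1 h2
      rw [PadicInt.dvd_iff_norm_le, hf.norm_sub hd, ← PadicInt.dvd_iff_norm_le] at h3
      have h4 : (p : ℤ_[p]) * (((T k + e k * p ^ k : ℕ) : ℤ_[p]) - (T (k + 1) : ℕ)) =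
          (p : ℤ_[p]) ^ (k + 1) * ((e k : ℤ_[p]) - J k (T k)) := by
        simp only [T]
        push_cast
        ring
      rw [h4, pow_succ _ (k + 1), mul_dvd_mul_iff_left
        (pow_ne_zero _ (by exact_mod_cast (Fact.out : p.Prime).ne_zero))] at h3
      have h5 : (p : ℤ) ∣ (e k : ℤ) - J k (T k) := by
        rw [← PadicInt.norm_int_lt_one_iff_dvd, PadicInt.norm_lt_one_iff_dvd]
        exact_mod_cast h3
      exact Nat.ModEq.eq_of_lt_of_lt ((Nat.modEq_iff_dvd.2 h5).symm) (he k) (hJ _ _)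

/-- Along the partial sums `f` tends to `0`, so the isometry property at `s` and a partial sum
passes to the limit, without extending `f` to `ℤ_[p]`. -/
theorem HasSlope.norm_eq_of_digits (hf : HasSlope f d) (hd : ¬ (p : ℤ_[p]) ∣ d) {e : ℕ → ℕ}
    (he : ∀ k, (p : ℤ_[p]) ^ (k + 1) ∣ f (∑ i ∈ Finset.range k, e i * p ^ i)) (s : ℕ) :
    ‖f s‖ = ‖(p : ℤ_[p]) * ((s : ℤ_[p]) - ∑' i, (e i : ℤ_[p]) * (p : ℤ_[p]) ^ i)‖ := by
  have hsum : Summable fun i => (e i : ℤ_[p]) * (p : ℤ_[p]) ^ i := by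
    refine Summable.of_norm_bounded (g := fun i => ((p : ℝ)⁻¹) ^ i)
      (summable_geometric_of_lt_one (by positivity)
        (inv_lt_one_of_one_lt₀ (by exact_mod_cast (Fact.out : p.Prime).one_lt))) fun i => ?_
    rw [norm_mul, norm_pow, PadicInt.norm_p]
    exact mul_le_of_le_one_left (by positivity) (PadicInt.norm_le_one _)
  have hT := hsum.hasSum.tendsto_sum_nat
  have hp0 : Filter.Tendsto (fun k : ℕ => (p : ℤ_[p]) ^ (k + 1)) Filter.atTop (nhds 0) :=
    (Filter.tendsto_add_atTop_iff_nat 1).2 (tendsto_pow_atTop_nhds_zero_of_norm_lt_one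
      (PadicInt.norm_lt_one_iff_dvd _ |>.2 dvd_rfl))
  have h0 : Filter.Tendsto (fun k => f (∑ i ∈ Finset.range k, e i * p ^ i)) Filter.atTop
      (nhds 0) :=
    squeeze_zero_norm (fun k => PadicInt.dvd_iff_norm_le.1 (he k)) (tendsto_norm_zero.comp hp0)
  have h1 := (h0.const_sub (f s)).norm
  rw [sub_zero] at h1
  refine tendsto_nhds_unique h1 ?_
  simp_rw [hf.norm_sub hd]
  push_cast
  exact ((hT.const_sub (s : ℤ_[p])).const_mul (p : ℤ_[p])).norm

end Digits

variable {p : Nat.Primes} {l : ℕ} {f : ℕ → ℤ_[(p : ℕ)]} {d : ℤ_[(p : ℕ)]}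

theorem sum_mul_totient_prime_pow (s : ℕ → ℕ) (k : ℕ) :
    ∑ ν ∈ Finset.range (k + 1), s ν * φ ((p : ℕ) ^ ν) =
      s 0 + ((p : ℕ) - 1) * ∑ i ∈ Finset.range k, s (i + 1) * (p : ℕ) ^ i := by
  rw [Finset.sum_range_succ', pow_zero, Nat.totient_one, mul_one, add_comm, Finset.mul_sum]
  congr 1
  refine Finset.sum_congr rfl fun i _ => ?_
  rw [Nat.totient_prime_pow_succ p.2]
  ring

theorem IsKummerFunction.isIrregularSequence_iff (hf : IsKummerFunction l f) (hl : 2 ≤ l)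
    (hlp : l < (p : ℕ) - 1) (he : Even l) (s : ℕ → ℕ) :
    IsIrregularSequence (p, l) s ↔ s 0 = l ∧ (∀ i, s (i + 1) < p) ∧
      ∀ k, ((p : ℕ) : ℤ_[(p : ℕ)]) ^ (k + 1) ∣
        f (∑ i ∈ Finset.range k, s (i + 1) * (p : ℕ) ^ i) := by
  have hodd : Even ((p : ℕ) - 1) := p.2.even_sub_one (by omega)
  simp only [IsIrregularSequence, IsIrregularPadicNotation]
  constructor
  · rintro ⟨h0, h⟩
    refine ⟨h0, fun i => (h (i + 2) (by omega)).1 (i + 1) (by omega), fun k => ?_⟩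
    have := (h (k + 1) (by omega)).2.2.2.2
    rw [sum_mul_totient_prime_pow, h0, hf.mem_irregularPairs_iff hl hlp he] at this
    exact this.2
  · rintro ⟨h0, h1, h2⟩
    refine ⟨h0, fun k hk => ?_⟩
    obtain ⟨k, rfl⟩ := Nat.exists_eq_add_of_le' hk
    rw [sum_mul_totient_prime_pow, h0, hf.mem_irregularPairs_iff hl hlp he]
    refine ⟨fun ν _ => ?_, he, hl, ?_, sum_digits_lt h1 k, h2 k⟩
    · rcases ν with _ | ν
      · omega
      · exact h1 ν
    -- Both `l` and `p - 1` are even, so `l < p - 1` improves to `l ≤ p - 3`.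
    · obtain ⟨a, ha⟩ := he
      obtain ⟨b, hb⟩ := hodd
      omega

theorem existsUnique_isIrregularSequence {x : Nat.Primes × ℕ} (hx : x ∈ irregularPairs 1)
    (hΔ : irregularDelta 1 x ≠ 0) : ∃! s : ℕ → ℕ, IsIrregularSequence x s := by
  obtain ⟨hl, hlp, he, f, d, hfd, hf, h0⟩ := IsKummerFunction.exists_of_mem hx
  rw [Ne, hf.irregularDelta_eq_zero_iff hfd hl hlp h0] at hΔ
  obtain ⟨e, ⟨he1, he2⟩, he3⟩ := hfd.existsUnique_digits hΔ h0
  refine ⟨fun n => Nat.casesOn n x.2 e,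
    (hf.isIrregularSequence_iff hl hlp he _).2 ⟨rfl, he1, he2⟩, fun s hs => ?_⟩
  obtain ⟨h1, h2, h3⟩ := (hf.isIrregularSequence_iff hl hlp he _).1 hs
  have := he3 (fun i => s (i + 1)) ⟨h2, h3⟩
  funext n
  rcases n with _ | n
  · exact h1
  · exact congrFun this n

theorem exists_eq_of_mem_irregularPairsAt {n : ℕ} {x : Nat.Primes × ℕ}
    (hx : x ∈ irregularPairsAt n) : ∃ s, n = x.2 + ((x.1 : ℕ) - 1) * s := by
  obtain ⟨hx1, hx2⟩ := hx
  obtain ⟨hl, hlp, -⟩ := IsKummerFunction.exists_of_mem hx1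
  refine ⟨n / ((x.1 : ℕ) - 1), ?_⟩
  have : n % ((x.1 : ℕ) - 1) = x.2 := by
    rw [hx2, Nat.mod_eq_of_lt hlp]
  conv_lhs => rw [← Nat.mod_add_div n ((x.1 : ℕ) - 1), this]

theorem norm_irregularChi_sub {n : ℕ} {x : Nat.Primes × ℕ}
    (hx : x ∈ irregularPairsAt n) (hΔ : irregularDelta 1 x ≠ 0) :
    ‖((x.1 : ℕ) : ℚ_[(x.1 : ℕ)]) * ((irregularChi x : ℚ_[(x.1 : ℕ)]) -
      ((n : ℚ_[(x.1 : ℕ)]) - (x.2 : ℚ_[(x.1 : ℕ)])) / (((x.1 : ℕ) : ℚ_[(x.1 : ℕ)]) - 1))‖ =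
      ‖((bernoulli n / n : ℚ) : ℚ_[(x.1 : ℕ)])‖ := by
  obtain ⟨s, rfl⟩ := exists_eq_of_mem_irregularPairsAt hx
  have hχ := Classical.epsilon_spec (existsUnique_isIrregularSequence hx.1 hΔ).exists
  obtain ⟨hl, hlp, he, f, d, hfd, hf, h0⟩ := IsKummerFunction.exists_of_mem hx.1
  rw [Ne, hf.irregularDelta_eq_zero_iff hfd hl hlp h0] at hΔ
  obtain ⟨-, -, h3⟩ := (hf.isIrregularSequence_iff hl hlp he _).1 hχ
  rw [← hf.norm_eq hl, hfd.norm_eq_of_digits hΔ h3, ← PadicInt.padic_norm_e_of_padicInt]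
  have hp1 : ((x.1 : ℕ) : ℚ_[(x.1 : ℕ)]) - 1 ≠ 0 := by
    rw [sub_ne_zero]
    exact_mod_cast x.1.2.one_lt.ne'
  have h1 : (((x.2 + ((x.1 : ℕ) - 1) * s : ℕ) : ℚ_[(x.1 : ℕ)]) - (x.2 : ℚ_[(x.1 : ℕ)])) /
      (((x.1 : ℕ) : ℚ_[(x.1 : ℕ)]) - 1) = s := by
    rw [div_eq_iff hp1]
    push_cast [Nat.cast_sub x.1.2.one_lt.le]
    ring
  rw [h1, ← norm_neg, irregularChi, PadicInt.coe_mul, PadicInt.coe_sub, PadicInt.coe_natCast,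
    PadicInt.coe_natCast]
  congr 1
  ring

end Nonsingular

/-! ### The singular case: heights in the tree -/

section Singular

variable {p : Nat.Primes} {l : ℕ} {f : ℕ → ℤ_[(p : ℕ)]} {d : ℤ_[(p : ℕ)]}

theorem HasSlope.pow_dvd_sub {p : ℕ} [Fact p.Prime] {f : ℕ → ℤ_[p]} {d : ℤ_[p]}
    (hfd : HasSlope f d) {r s t : ℕ} (h : s ≡ t [MOD p ^ r]) :
    (p : ℤ_[p]) ^ (r + 1) ∣ f s - f t := by
  obtain ⟨x, hx⟩ := hfd.exists_eq s t
  obtain ⟨y, hy⟩ := Nat.modEq_iff_dvd.1 h.symm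
  have hy' := congrArg (fun z : ℤ => (z : ℤ_[p])) hy
  push_cast at hy'
  exact ⟨y * (d + p * x), by rw [hx, hy']; ring⟩

theorem HasSlope.pow_dvd_sub_of_dvd {p : ℕ} [Fact p.Prime] {f : ℕ → ℤ_[p]} {d : ℤ_[p]}
    (hfd : HasSlope f d) (hd : (p : ℤ_[p]) ∣ d) {r s t : ℕ} (h : s ≡ t [MOD p ^ r]) :
    (p : ℤ_[p]) ^ (r + 2) ∣ f s - f t := by
  obtain ⟨x, hx⟩ := hfd.exists_eq s t
  obtain ⟨d', rfl⟩ := hd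
  obtain ⟨y, hy⟩ := Nat.modEq_iff_dvd.1 h.symm
  have hy' := congrArg (fun z : ℤ => (z : ℤ_[p])) hy
  push_cast at hy'
  exact ⟨y * (d' + x), by rw [hx, hy']; ring⟩

/-- The condition `p ^ (r + 2) ∣ f t` for having children is inherited by every `t + p ^ r * j`;
conversely it descends from `t` to `t % p ^ r`, which locates the parent. -/
theorem IsKummerFunction.singularTreeNode_iff (hfd : HasSlope f d) (hf : IsKummerFunction l f)
    (hl : 2 ≤ l) (hlp : l < (p : ℕ) - 1) (he : Even l) (h0 : ((p : ℕ) : ℤ_[(p : ℕ)]) ∣ f 0)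
    (hd : ((p : ℕ) : ℤ_[(p : ℕ)]) ∣ d) (r m : ℕ) :
    SingularTreeNode p l r m ↔ ∃ t < (p : ℕ) ^ r, m = l + ((p : ℕ) - 1) * t ∧
      ((p : ℕ) : ℤ_[(p : ℕ)]) ^ (r + 1) ∣ f t := by
  have hpp := p.2.pos
  have hstep : ∀ r j t : ℕ, l + ((p : ℕ) - 1) * t + j * φ ((p : ℕ) ^ (r + 1)) =
      l + ((p : ℕ) - 1) * (t + (p : ℕ) ^ r * j) := by
    intro r j t
    rw [Nat.totient_prime_pow_succ p.2]
    ring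
  have hmod : ∀ r j t : ℕ, t + (p : ℕ) ^ r * j ≡ t [MOD (p : ℕ) ^ r] := fun r j t => by
    simp [Nat.ModEq]
  constructor
  · intro h
    induction h with
    | root => exact ⟨0, by positivity, by simp, by simpa using h0⟩
    | @child r m j _ hmem hj ih =>
      obtain ⟨t, ht, rfl, -⟩ := ih
      rw [hf.mem_irregularPairs_iff hl hlp he] at hmem
      refine ⟨t + (p : ℕ) ^ r * j, ?_, hstep r j t, ?_⟩
      · have := Nat.mul_le_mul_left ((p : ℕ) ^ r) (Nat.succ_le_of_lt hj)
        rw [Nat.mul_succ] at this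
        rw [pow_succ]
        omega
      · exact (dvd_sub_left hmem.2).1 (hfd.pow_dvd_sub_of_dvd hd (hmod r j t))
  · induction r generalizing m with
    | zero =>
      rintro ⟨t, ht, rfl, -⟩
      obtain rfl : t = 0 := by simpa using ht
      exact SingularTreeNode.root
    | succ r ih =>
      rintro ⟨t, ht, rfl, hft⟩
      have hdiv := Nat.mod_add_div t ((p : ℕ) ^ r)
      have ht' : t % (p : ℕ) ^ r < (p : ℕ) ^ r := Nat.mod_lt _ (pow_pos hpp r)
      have hft' : ((p : ℕ) : ℤ_[(p : ℕ)]) ^ (r + 2) ∣ f (t % (p : ℕ) ^ r) :=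
        (dvd_sub_right hft).1 (hfd.pow_dvd_sub_of_dvd hd (Nat.mod_modEq t _).symm)
      rw [← hdiv, ← hstep]
      refine SingularTreeNode.child _ (ih _ ⟨_, ht', rfl, (pow_dvd_pow _ (by omega)).trans hft'⟩)
        ((hf.mem_irregularPairs_iff hl hlp he _ _).2 ⟨?_, hft'⟩)
        (Nat.div_lt_of_lt_mul (by rwa [← pow_succ]))
      exact ht'.trans_le (Nat.pow_le_pow_right hpp (Nat.le_succ r))

/-- Reducing `n` modulo `φ (p ^ (r + 1))` reduces `s` modulo `p ^ r`, which preserves `f s` modulo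
`p ^ (r + 1)`. So `r` is a height exactly when `p ^ (r + 1) ∣ f s`; these `r` are bounded as `B_n ≠
0`. -/
theorem isGreatest_singularHeights {n : ℕ} (hpos : 0 < n) (hB : bernoulli n ≠ 0)
    {x : Nat.Primes × ℕ} (hx : x ∈ irregularPairsAt n) (hΔ : irregularDelta 1 x = 0) :
    IsGreatest (singularHeights x n) (singularHeight x n) ∧
      ((x.1 : ℕ) : ℝ) ^ (1 + singularHeight x n) =
        ‖((bernoulli n / n : ℚ) : ℚ_[(x.1 : ℕ)])‖⁻¹ := by
  obtain ⟨s, hs⟩ := exists_eq_of_mem_irregularPairsAt hx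
  obtain ⟨hl, hlp, he, f, d, hfd, hf, h0⟩ := IsKummerFunction.exists_of_mem hx.1
  rw [hf.irregularDelta_eq_zero_iff hfd hl hlp h0] at hΔ
  have hnorm : ‖f s‖ = ‖((bernoulli n / n : ℚ) : ℚ_[(x.1 : ℕ)])‖ := by rw [hf.norm_eq hl, hs]
  have hfs : f s ≠ 0 := by
    rw [← norm_ne_zero_iff, hnorm, norm_ne_zero_iff, Rat.cast_ne_zero]
    exact div_ne_zero hB (by exact_mod_cast hpos.ne')
  have hmem : ∀ r, r ∈ singularHeights x n ↔ r + 1 ≤ (f s).valuation := by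
    intro r
    have hmod : n % φ ((x.1 : ℕ) ^ (r + 1)) =
        x.2 + ((x.1 : ℕ) - 1) * (s % (x.1 : ℕ) ^ r) := by
      have hlt : s % (x.1 : ℕ) ^ r < (x.1 : ℕ) ^ r := Nat.mod_lt _ (pow_pos x.1.2.pos r)
      have h1 := Nat.mul_le_mul_left ((x.1 : ℕ) - 1) (Nat.succ_le_of_lt hlt)
      rw [Nat.mul_succ, mul_comm _ ((x.1 : ℕ) ^ r)] at h1
      rw [Nat.totient_prime_pow_succ x.1.2, hs]
      conv_lhs => rw [← Nat.mod_add_div s ((x.1 : ℕ) ^ r), mul_add, ← add_assoc, ← mul_assoc,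
        mul_comm _ ((x.1 : ℕ) ^ r), Nat.add_mul_mod_self_left]
      exact Nat.mod_eq_of_lt (by omega)
    have hinj : ∀ t, x.2 + ((x.1 : ℕ) - 1) * (s % (x.1 : ℕ) ^ r) = x.2 + ((x.1 : ℕ) - 1) * t →
        s % (x.1 : ℕ) ^ r = t := fun t h =>
      Nat.eq_of_mul_eq_mul_left (by omega) (Nat.add_left_cancel h)
    rw [← PadicInt.mem_span_pow_iff_le_valuation _ hfs, Ideal.mem_span_singleton]
    simp only [singularHeights, Set.mem_ofPred_eq]
    rw [hf.singularTreeNode_iff hfd hl hlp he h0 hΔ, hmod]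
    have hsub := hfd.pow_dvd_sub (Nat.mod_modEq s ((x.1 : ℕ) ^ r)).symm
    constructor
    · rintro ⟨t, -, ht, hft⟩
      rw [← hinj t ht] at hft
      exact (dvd_sub_left hft).1 hsub
    · intro h
      exact ⟨_, Nat.mod_lt _ (pow_pos x.1.2.pos r), rfl, (dvd_sub_right h).1 hsub⟩
  have hv : 1 ≤ (f s).valuation := by
    rw [← PadicInt.mem_span_pow_iff_le_valuation _ hfs, Ideal.mem_span_singleton, pow_one]
    have := hfd.pow_dvd_sub (r := 0) (s := s) (t := 0) (by simp [Nat.modEq_one])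
    rw [zero_add, pow_one] at this
    exact (dvd_sub_left h0).1 this
  have hgr : IsGreatest (singularHeights x n) ((f s).valuation - 1) := by
    refine ⟨(hmem _).2 (by omega), fun r hr => ?_⟩
    have := (hmem r).1 hr
    omega
  have hh : singularHeight x n = (f s).valuation - 1 := hgr.csSup_eq
  rw [hh]
  refine ⟨hgr, ?_⟩
  rw [← hnorm, PadicInt.norm_eq_zpow_neg_valuation hfs, zpow_neg, inv_inv, zpow_natCast]
  congr 1
  omega

end Singular

/-! ### The sign and the zeta value -/

section Zeta

/-- Euler's formula expresses the positive number `ζ(2k)` as a positive multiple of this quantity.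
-/
theorem bernoulli_pos_mul {k : ℕ} (hk : k ≠ 0) : 0 < (-1 : ℝ) ^ (k + 1) * bernoulli (2 * k) := by
  have h := hasSum_zeta_nat hk
  have h1 : (0 : ℝ) < ∑' n : ℕ, 1 / (n : ℝ) ^ (2 * k) :=
    h.summable.tsum_pos (fun n => by positivity) 1 (by simp)
  rw [h.tsum_eq] at h1
  have h2 : (0 : ℝ) < (2 : ℝ) ^ (2 * k - 1) * Real.pi ^ (2 * k) / (2 * k)! := by positivity
  refine pos_of_mul_pos_left ?_ h2.le
  convert! h1 using 1
  ring

theorem bernoulli_ne_zero_of_even {n : ℕ} (hn : Even n) (hpos : 0 < n) : bernoulli n ≠ 0 := by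
  obtain ⟨k, rfl⟩ := even_iff_two_dvd.1 hn
  intro h
  have := bernoulli_pos_mul (k := k) (by omega)
  rw [h] at this
  simp at this

theorem riemannZeta_one_sub_even {n : ℕ} (hn : Even n) (hpos : 0 < n) :
    riemannZeta (1 - (n : ℂ)) =
      (-1 : ℂ) ^ (n / 2) * ((((|bernoulli n / n| : ℚ) : ℝ)) : ℂ) := by
  obtain ⟨k, rfl⟩ := even_iff_two_dvd.1 hn
  have hk : k ≠ 0 := by omega
  have hcast : (1 : ℂ) - ((2 * k : ℕ) : ℂ) = -((2 * k - 1 : ℕ) : ℂ) := by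
    rw [Nat.cast_sub (by omega)]
    push_cast
    ring
  have habs : ((|bernoulli (2 * k) / ((2 * k : ℕ) : ℚ)| : ℚ) : ℝ) =
      (-1 : ℝ) ^ (k + 1) * (bernoulli (2 * k) / ((2 * k : ℕ) : ℚ) : ℚ) := by
    have h := bernoulli_pos_mul hk
    rw [Rat.cast_abs]
    push_cast
    rw [abs_div, mul_div_assoc', abs_of_pos (by positivity : (0 : ℝ) < 2 * (k : ℝ)),
      ← abs_of_pos h, abs_mul, abs_pow, abs_neg, abs_one, one_pow, one_mul]
  rw [hcast, riemannZeta_neg_nat_eq_bernoulli', habs, Nat.mul_div_cancel_left k two_pos,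
    show 2 * k - 1 + 1 = 2 * k by omega,
    ← bernoulli_eq_bernoulli'_of_ne_one (by omega : 2 * k ≠ 1), Nat.cast_sub (by omega)]
  push_cast
  have hsq : ((-1 : ℂ) ^ k) * (-1) ^ k = 1 := by rw [← mul_pow]; norm_num
  rw [pow_succ, sub_add_cancel]
  linear_combination ((bernoulli (2 * k) : ℂ) / (2 * k)) * hsq

end Zeta

/-! ### The product formula over the primes -/

section ProductFormula

theorem finite_primes_le (N : ℕ) : {p : Nat.Primes | (p : ℕ) ≤ N}.Finite :=
  Set.Finite.of_finite_image ((Set.finite_Iic N).subset (by rintro _ ⟨p, hp, rfl⟩; exact hp))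
    (Nat.Primes.coe_nat_injective.injOn)

theorem finite_norm_natCast_ne_one {N : ℕ} (hN : N ≠ 0) :
    (Function.mulSupport fun p : Nat.Primes => ‖(N : ℚ_[(p : ℕ)])‖⁻¹).Finite := by
  refine Set.Finite.subset (finite_primes_le N) fun p hp => ?_
  rw [Function.mem_mulSupport, Ne, inv_eq_one, Padic.norm_natCast_eq_one_iff,
    Nat.Prime.coprime_iff_not_dvd p.2, not_not] at hp
  exact Nat.le_of_dvd (Nat.pos_of_ne_zero hN) hp

theorem finprod_norm_natCast_inv {N : ℕ} (hN : N ≠ 0) :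
    ∏ᶠ p : Nat.Primes, ‖(N : ℚ_[(p : ℕ)])‖⁻¹ = (N : ℝ) := by
  induction N using induction_on_primes with
  | zero => exact absurd rfl hN
  | one => simp
  | prime_mul q a hq ih =>
    have ha : a ≠ 0 := right_ne_zero_of_mul hN
    have hfun : ∀ p : Nat.Primes, ‖((q * a : ℕ) : ℚ_[(p : ℕ)])‖⁻¹ =
        ‖(q : ℚ_[(p : ℕ)])‖⁻¹ * ‖(a : ℚ_[(p : ℕ)])‖⁻¹ := fun p => by
      rw [Nat.cast_mul, norm_mul, mul_inv]
    simp_rw [hfun]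
    rw [finprod_mul_distrib (finite_norm_natCast_ne_one hq.ne_zero)
      (finite_norm_natCast_ne_one ha), ih ha, finprod_eq_single _ ⟨q, hq⟩ fun p hp => ?_]
    · push_cast
      congr 1
      have : Fact q.Prime := ⟨hq⟩
      exact (congrArg _ (Padic.norm_p (p := q))).trans (inv_inv _)
    · rw [inv_eq_one, Padic.norm_natCast_eq_one_iff, Nat.coprime_primes p.2 hq]
      exact fun h => hp (Subtype.ext h)

/-- The product formula for the rational numbers. -/
theorem finprod_norm_ratCast_inv {q : ℚ} (hq : q ≠ 0) :
    ∏ᶠ p : Nat.Primes, ‖(q : ℚ_[(p : ℕ)])‖⁻¹ = ((|q| : ℚ) : ℝ) := by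
  have hnum : q.num.natAbs ≠ 0 := by simpa using hq
  have hfun : ∀ p : Nat.Primes, ‖(q : ℚ_[(p : ℕ)])‖⁻¹ =
      ‖(q.num.natAbs : ℚ_[(p : ℕ)])‖⁻¹ / ‖(q.den : ℚ_[(p : ℕ)])‖⁻¹ := fun p => by
    have h : (q : ℚ_[(p : ℕ)]) = (q.num : ℚ_[(p : ℕ)]) / (q.den : ℚ_[(p : ℕ)]) := by
      exact_mod_cast congrArg (fun x : ℚ => (x : ℚ_[(p : ℕ)])) (Rat.num_div_den q).symm
    have h' : ‖(q.num.natAbs : ℚ_[(p : ℕ)])‖ = ‖(q.num : ℚ_[(p : ℕ)])‖ := by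
      rcases Int.natAbs_eq q.num with h | h
      · conv_rhs => rw [h]
        rw [Int.cast_natCast]
      · conv_rhs => rw [h]
        rw [Int.cast_neg, norm_neg, Int.cast_natCast]
    rw [h, h', norm_div, inv_div, inv_div_inv]
  simp_rw [hfun]
  rw [finprod_div_distrib (finite_norm_natCast_ne_one hnum) (finite_norm_natCast_ne_one q.den_nz),
    finprod_norm_natCast_inv hnum, finprod_norm_natCast_inv q.den_nz, Rat.abs_def,
    Rat.divInt_eq_div]
  push_cast
  rw [Nat.cast_natAbs, Int.cast_abs]

end ProductFormula

/-! ### Local factors of `B_n / n` and finiteness -/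

section LocalFactors

/-- In von Staudt–Clausen the only term not integral at `p` is `1 / p`, so it dominates. -/
theorem norm_bernoulli_of_sub_one_dvd {p : ℕ} [Fact p.Prime] {n : ℕ} (hn : Even n) (hpos : 0 < n)
    (hp : p - 1 ∣ n) : ‖((bernoulli n : ℚ) : ℚ_[p])‖ = p := by
  have hpp : p.Prime := Fact.out
  obtain ⟨k, rfl⟩ := even_iff_two_dvd.1 hn
  obtain ⟨z, hz⟩ := Bernoulli.vonStaudt_clausen k
  have hmem : p ∈ (Finset.range (2 * k + 2)).filter fun q => q.Prime ∧ q - 1 ∣ 2 * k := by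
    have := Nat.le_of_dvd hpos hp
    simp only [Finset.mem_filter, Finset.mem_range]
    exact ⟨by omega, hpp, hp⟩
  rw [← Finset.add_sum_erase _ _ hmem] at hz
  have hB := congrArg (fun x : ℚ => (x : ℚ_[p])) hz
  push_cast at hB
  have hw : ‖(z : ℚ_[p]) - ∑ q ∈ ((Finset.range (2 * k + 2)).filter
      fun q => q.Prime ∧ q - 1 ∣ 2 * k).erase p, 1 / (q : ℚ_[p])‖ ≤ 1 := by
    refine (PadicInt.subring p).sub_mem (Padic.norm_int_le_one z)
      ((PadicInt.subring p).sum_mem fun q hq => ?_)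
    simp only [Finset.mem_erase, Finset.mem_filter] at hq
    change ‖1 / (q : ℚ_[p])‖ ≤ 1
    rw [norm_div, norm_one, Padic.norm_natCast_eq_one_iff.2
      ((Nat.coprime_primes hpp hq.2.2.1).2 (Ne.symm hq.1)), div_one]
  have hp1 : (1 : ℝ) < p := by exact_mod_cast hpp.one_lt
  have hinv : ‖-(1 / (p : ℚ_[p]))‖ = p := by simp
  have hBeq : ((bernoulli (2 * k) : ℚ) : ℚ_[p]) = -(1 / (p : ℚ_[p])) +
      ((z : ℚ_[p]) - ∑ q ∈ ((Finset.range (2 * k + 2)).filter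
      fun q => q.Prime ∧ q - 1 ∣ 2 * k).erase p, 1 / (q : ℚ_[p])) := by
    linear_combination -hB
  rw [hBeq, Padic.add_eq_max_of_ne (by rw [hinv]; exact (hw.trans_lt hp1).ne'), hinv,
    max_eq_left (hw.trans hp1.le)]

theorem norm_bernoulli_div_of_mem {n : ℕ} {x : Nat.Primes × ℕ}
    (hx : x ∈ irregularPairsAt n) : ‖((bernoulli n / n : ℚ) : ℚ_[(x.1 : ℕ)])‖ < 1 := by
  obtain ⟨s, hs⟩ := exists_eq_of_mem_irregularPairsAt hx
  obtain ⟨hl, hlp, he, f, d, hfd, hf, h0⟩ := IsKummerFunction.exists_of_mem hx.1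
  rw [hs, ← hf.norm_eq hl, PadicInt.norm_lt_one_iff_dvd]
  have := hfd.pow_dvd_sub (r := 0) (s := s) (t := 0) (by simp [Nat.modEq_one])
  rw [zero_add, pow_one] at this
  exact (dvd_sub_left h0).1 this

/-- The value `f s` is integral, so norm different from `1` means `p ∣ f s`; as `f` is constant
modulo `p`, the residue `l` of `n` already gives an irregular pair. -/
theorem exists_mem_irregularPairsAt {n : ℕ} (hn : Even n) {p : Nat.Primes}
    (hp : ¬ (p : ℕ) - 1 ∣ n) (hB : ‖((bernoulli n / n : ℚ) : ℚ_[(p : ℕ)])‖ ≠ 1) :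
    ∃ x ∈ irregularPairsAt n, x.1 = p := by
  have hp2 : (p : ℕ) ≠ 2 := fun h => hp (by simp [h])
  have hev : Even ((p : ℕ) - 1) := p.2.even_sub_one hp2
  have hp1 : 0 < (p : ℕ) - 1 := Nat.sub_pos_of_lt p.2.one_lt
  have hdiv := Nat.mod_add_div n ((p : ℕ) - 1)
  have hlp : n % ((p : ℕ) - 1) < (p : ℕ) - 1 := Nat.mod_lt _ hp1
  have hl0 : n % ((p : ℕ) - 1) ≠ 0 := fun h => hp (Nat.dvd_of_mod_eq_zero h)
  have hmod : n ≡ n % ((p : ℕ) - 1) [MOD (p : ℕ) - 1] := (Nat.mod_modEq _ _).symm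
  have he : Even (n % ((p : ℕ) - 1)) := by
    rw [← hdiv, Nat.even_add] at hn
    exact hn.2 (hev.mul_right _)
  generalize n % ((p : ℕ) - 1) = l at *
  generalize n / ((p : ℕ) - 1) = s at *
  subst hdiv
  have hl : 2 ≤ l := by
    obtain ⟨a, ha⟩ := he
    omega
  obtain ⟨f, d, hfd, hf⟩ := exists_hasSlope_bernoulli (p := (p : ℕ)) hp2
    (fun h => absurd (Nat.le_of_dvd (by omega) h) (by omega) : ¬ (p : ℕ) - 1 ∣ l)
  change IsKummerFunction l f at hf
  rw [← hf.norm_eq hl] at hB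
  have h1 : ((p : ℕ) : ℤ_[(p : ℕ)]) ∣ f s := by
    rw [← PadicInt.norm_lt_one_iff_dvd]
    exact lt_of_le_of_ne (PadicInt.norm_le_one _) hB
  have h2 := hfd.pow_dvd_sub (r := 0) (s := s) (t := 0) (by simp [Nat.modEq_one])
  rw [zero_add, pow_one] at h2
  refine ⟨(p, l), ⟨?_, hmod⟩, rfl⟩
  have h3 := (hf.mem_irregularPairs_iff hl hlp he 0 0).2
    ⟨by simp, by simpa using (dvd_sub_right h1).1 h2⟩
  simpa using h3

theorem injOn_fst_irregularPairsAt (n : ℕ) : Set.InjOn Prod.fst (irregularPairsAt n) := by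
  rintro ⟨p, l⟩ hx ⟨q, l'⟩ hy (rfl : p = q)
  obtain ⟨-, hlp, -⟩ := IsKummerFunction.exists_of_mem hx.1
  obtain ⟨-, hlp', -⟩ := IsKummerFunction.exists_of_mem hy.1
  exact Prod.ext rfl (Nat.ModEq.eq_of_lt_of_lt (hx.2.symm.trans hy.2) hlp hlp')

theorem not_sub_one_dvd_of_mem {n : ℕ} {x : Nat.Primes × ℕ} (hx : x ∈ irregularPairsAt n) :
    ¬ (x.1 : ℕ) - 1 ∣ n := by
  obtain ⟨hl, hlp, -⟩ := IsKummerFunction.exists_of_mem hx.1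
  rw [hx.2.dvd_iff dvd_rfl]
  exact fun h => absurd (Nat.le_of_dvd (by omega) h) (by omega)

theorem finite_sub_one_dvd {n : ℕ} (hpos : 0 < n) :
    {p : Nat.Primes | (p : ℕ) - 1 ∣ n}.Finite := by
  refine Set.Finite.subset (finite_primes_le (n + 1)) fun p hp => ?_
  have := Nat.le_of_dvd hpos hp
  change (p : ℕ) ≤ n + 1
  omega

/-- Each such prime divides the nonzero numerator of `B_n / n`, and it determines `l`. -/
theorem finite_irregularPairsAt {n : ℕ} (hn : Even n) (hpos : 0 < n) :
    (irregularPairsAt n).Finite := by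
  refine Set.Finite.of_finite_image ?_ (injOn_fst_irregularPairsAt n)
  have hq : bernoulli n / (n : ℚ) ≠ 0 :=
    div_ne_zero (bernoulli_ne_zero_of_even hn hpos) (by exact_mod_cast hpos.ne')
  refine Set.Finite.subset (finite_primes_le (bernoulli n / (n : ℚ)).num.natAbs) ?_
  rintro _ ⟨x, hx, rfl⟩
  have h1 : ((x.1 : ℕ) : ℤ) ^ 1 ∣ (bernoulli n / (n : ℚ)).num := by
    obtain ⟨s, hs⟩ := exists_eq_of_mem_irregularPairsAt hx
    obtain ⟨hl, -, -, f, d, -, hf, -⟩ := IsKummerFunction.exists_of_mem hx.1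
    have h := norm_bernoulli_div_of_mem hx
    rw [hs] at h ⊢
    rwa [hf.pow_dvd_num_iff hl s one_ne_zero, pow_one, ← PadicInt.norm_lt_one_iff_dvd,
      hf.norm_eq hl]
  rw [pow_one, Int.natCast_dvd] at h1
  exact Nat.le_of_dvd (Int.natAbs_pos.2 (Rat.num_ne_zero.2 hq)) h1

end LocalFactors

/-! ### Assembly of the local factors -/

theorem mainTheorem6 (n : ℕ) (hn : Even n) (hpos : 0 < n) :
    -- the characteristic numbers, the heights and the products are well defined
    (∀ x ∈ irregularPairs 1, irregularDelta 1 x ≠ 0 → ∃! s : ℕ → ℕ, IsIrregularSequence x s) ∧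
    (∀ x ∈ irregularPairsAt n, irregularDelta 1 x = 0 →
      IsGreatest (singularHeights x n) (singularHeight x n)) ∧
    (irregularPairsAt n).Finite ∧
    {p : Nat.Primes | (p : ℕ) - 1 ∣ n}.Finite ∧
    -- the product formula
    riemannZeta (1 - (n : ℂ)) = (-1 : ℂ) ^ (n / 2) *
      (((∏ᶠ x ∈ {x : Nat.Primes × ℕ | x ∈ irregularPairsAt n ∧ irregularDelta 1 x ≠ 0},
            ‖((x.1 : ℕ) : ℚ_[(x.1 : ℕ)]) * ((irregularChi x : ℚ_[(x.1 : ℕ)]) -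
              ((n : ℚ_[(x.1 : ℕ)]) - (x.2 : ℚ_[(x.1 : ℕ)])) /
                (((x.1 : ℕ) : ℚ_[(x.1 : ℕ)]) - 1))‖⁻¹) *
        (∏ᶠ x ∈ {x : Nat.Primes × ℕ | x ∈ irregularPairsAt n ∧ irregularDelta 1 x = 0},
            ((x.1 : ℕ) : ℝ) ^ (1 + singularHeight x n)) *
        (∏ᶠ p ∈ {p : Nat.Primes | (p : ℕ) - 1 ∣ n},
            ‖(n : ℚ_[(p : ℕ)])‖ / ((p : ℕ) : ℝ)) : ℝ) : ℂ) := by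
  have hB := bernoulli_ne_zero_of_even hn hpos
  have hq : bernoulli n / (n : ℚ) ≠ 0 := div_ne_zero hB (by exact_mod_cast hpos.ne')
  have hfin := finite_irregularPairsAt hn hpos
  have hfin' := finite_sub_one_dvd hpos
  refine ⟨fun x hx hΔ => existsUnique_isIrregularSequence hx hΔ,
    fun x hx hΔ => (isGreatest_singularHeights hpos hB hx hΔ).1, hfin, hfin', ?_⟩
  rw [riemannZeta_one_sub_even hn hpos, ← finprod_norm_ratCast_inv hq]
  congr 2
  let N : Nat.Primes → ℝ := fun p => ‖((bernoulli n / n : ℚ) : ℚ_[(p : ℕ)])‖⁻¹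
  have e1 := finprod_mem_congr rfl (f := fun x : Nat.Primes × ℕ =>
      ‖((x.1 : ℕ) : ℚ_[(x.1 : ℕ)]) * ((irregularChi x : ℚ_[(x.1 : ℕ)]) -
        ((n : ℚ_[(x.1 : ℕ)]) - (x.2 : ℚ_[(x.1 : ℕ)])) / (((x.1 : ℕ) : ℚ_[(x.1 : ℕ)]) - 1))‖⁻¹)
    (g := fun x => N x.1)
    fun x (hx : x ∈ {x : Nat.Primes × ℕ | x ∈ irregularPairsAt n ∧ irregularDelta 1 x ≠ 0}) =>
      congrArg _ (norm_irregularChi_sub hx.1 hx.2)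
  have e2 := finprod_mem_congr rfl (f := fun x : Nat.Primes × ℕ =>
      ((x.1 : ℕ) : ℝ) ^ (1 + singularHeight x n)) (g := fun x => N x.1)
    fun x (hx : x ∈ {x : Nat.Primes × ℕ | x ∈ irregularPairsAt n ∧ irregularDelta 1 x = 0}) =>
      (isGreatest_singularHeights hpos hB hx.1 hx.2).2
  have e3 := finprod_mem_congr rfl (f := fun p : Nat.Primes => ‖(n : ℚ_[(p : ℕ)])‖ / ((p : ℕ) : ℝ))
    (g := N) fun p (hp : p ∈ {p : Nat.Primes | (p : ℕ) - 1 ∣ n}) => by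
      simp only [N]
      rw [Rat.cast_div, norm_div, norm_bernoulli_of_sub_one_dvd hn hpos hp, inv_div,
        Rat.cast_natCast]
  rw [e1, e2, e3, ← finprod_mem_union ?_ (hfin.subset fun x hx => hx.1)
    (hfin.subset fun x hx => hx.1)]
  · have hunion : {x : Nat.Primes × ℕ | x ∈ irregularPairsAt n ∧ irregularDelta 1 x ≠ 0} ∪
        {x | x ∈ irregularPairsAt n ∧ irregularDelta 1 x = 0} = irregularPairsAt n := by
      ext x
      simp only [Set.mem_union, Set.mem_ofPred_eq]
      tauto
    -- Irregular pairs at `n` are reindexed by their primes, which are disjoint from those with `p -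
    -- 1 ∣ n`. At all remaining primes `N p = 1`.
    rw [hunion, ← finprod_mem_image (f := N) (injOn_fst_irregularPairsAt n),
      ← finprod_mem_union ?_ (hfin.image _) hfin']
    · rw [← finprod_mem_univ]
      refine finprod_mem_inter_mulSupport_eq' _ _ _ fun p hp => ?_
      simp only [Set.mem_univ, true_iff]
      by_cases h : (p : ℕ) - 1 ∣ n
      · exact Or.inr h
      · obtain ⟨x, hx, rfl⟩ := exists_mem_irregularPairsAt hn h fun h1 =>
          hp (inv_eq_one.2 h1)
        exact Or.inl ⟨x, hx, rfl⟩
    · rw [Set.disjoint_left]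
      rintro _ ⟨x, hx, rfl⟩ h
      exact not_sub_one_dvd_of_mem hx h
  · rw [Set.disjoint_left]
    exact fun x hx hx' => hx.2 hx'.2
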